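/- A cognitive radio network consists of a finite set $U$ of $n\ge 1$ secondary users, a finite set $C$ of $k$ channels, a potential graph $\mathcal{PG}=(U,E)$, and, for every user $u\in U$, a spectrum map $\mathrm{SpecMap}(u)\subseteq C$ and an antenna budget $\beta(u)\in\mathbb{N}$. A spectrum assignment is a map $SA:U\to 2^C$ with $SA(u)\subseteq\mathrm{SpecMap}(u)$ and $|SA(u)|\le\beta(u)$ for all $u\in U$. Its realization graph has vertex set $U$ and as edges all $\{u,v\}\in E$ with $SA(u)\cap SA(v)\ne\emptyset$. The network is connectable if some spectrum assignment has a connected realization graph. Theorem. Consider the problem of deciding whether a given cognitive radio network whose potential graph is complete is connectable. (1) The problem can be solved in time $2^{2^k+O(k)}\,n^{O(1)}$: there are a single algorithm and constants $a,b$ such that on every network with $n\ge1$ users, $k\ge 0$ channels and complete potential graph the algorithm halts with the correct answer after at most $2^{2^k+a(k+1)}\,n^{b}$ steps. (2) The problem is fixed-parameter tractable when parameterized by the number $k$ of channels: there are a single algorithm, a computable function $f$ and a constant $d$ such that every such network, with an encoding of bit length $L$, is decided correctly in at most $f(k)\,L^{d}$ steps. Here an algorithm is a program for a random access machine on natural numbers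 with the elementary operations of loading a constant, addition, truncated subtraction, and indirect reading and writing of memory, and with tests for zero, where every operation and every test costs one step. The input consists of $n$, $k$, the budgets $\beta(u)$ (one number each), the $n\times k$ $0/1$-matrix of the spectrum maps and the $n\times n$ adjacency matrix of the potential graph. The bit length of an input is the sum, over its numbers, of their binary lengths plus one. -/

import Mathlib

/-- A cognitive radio network with secondary users `U` and channels `C`. -/
structure CRN (U C : Type*) where
  /-- the channels available to each user -/
  specMap : U → Finset C
  /-- the potential graph -/
  graph : SimpleGraph U
  /-- the antenna budget of each user -/
  budget : U → ℕ

namespace CRN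

variable {U C : Type*}

/-- Every user opens only channels of its spectrum map, and at most as many as its budget. -/
def IsSpectrumAssignment (N : CRN U C) (SA : U → Finset C) : Prop :=
  ∀ u, SA u ⊆ N.specMap u ∧ (SA u).card ≤ N.budget u

/-- The spanning subgraph of the potential graph formed by the realized edges: the potential edges
whose two endpoints open a common channel. -/
def realizationGraph (N : CRN U C) (SA : U → Finset C) : SimpleGraph U where
  Adj u v := N.graph.Adj u v ∧ ∃ c, c ∈ SA u ∧ c ∈ SA v
  symm := ⟨fun _ _ h => ⟨h.1.symm, h.2.imp fun _ hc => ⟨hc.2, hc.1⟩⟩⟩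
  loopless := ⟨fun u h => N.graph.loopless.irrefl u h.1⟩

/-- Some spectrum assignment makes the realization graph connected. -/
def Connectable (N : CRN U C) : Prop :=
  ∃ SA : U → Finset C, N.IsSpectrumAssignment SA ∧ (N.realizationGraph SA).Connected

open Classical in
/-- The input given to an algorithm: the numbers `n` and `k`, the `n` budgets, the `n × k`
incidence matrix of the spectrum maps and the `n × n` adjacency matrix of the potential graph, both
row by row with entries `0` and `1`. -/
noncomputable def encode {n k : ℕ} (N : CRN (Fin n) (Fin k)) : List ℕ :=
  [n, k] ++ List.ofFn N.budget
    ++ (List.finRange n).flatMap (fun u =>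
        (List.finRange k).map fun c => if c ∈ N.specMap u then 1 else 0)
    ++ (List.finRange n).flatMap (fun u =>
        (List.finRange n).map fun v => if N.graph.Adj u v then 1 else 0)

end CRN

/-- Programs of a random access machine with registers `R 0, R 1, …` and memory cells
`M 0, M 1, …`, all of which hold natural numbers. -/
inductive RAMProg : Type
  /-- do nothing -/
  | skip : RAMProg
  /-- `R r := c` -/
  | const (r c : ℕ) : RAMProg
  /-- `R r := R s + R t` -/
  | add (r s t : ℕ) : RAMProg
  /-- `R r := R s - R t`, truncated at `0` -/
  | sub (r s t : ℕ) : RAMProg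
  /-- `R r := M (R s)` -/
  | load (r s : ℕ) : RAMProg
  /-- `M (R r) := R s` -/
  | store (r s : ℕ) : RAMProg
  /-- run `p`, then `q` -/
  | seq (p q : RAMProg) : RAMProg
  /-- if `R r ≠ 0` run `p`, otherwise run `q` -/
  | ite (r : ℕ) (p q : RAMProg) : RAMProg
  /-- as long as `R r ≠ 0` run `p` -/
  | while (r : ℕ) (p : RAMProg) : RAMProg

/-- The contents of the registers and of the memory cells. -/
structure RAMState where
  reg : ℕ → ℕ
  mem : ℕ → ℕ

/-- `RAMRun p σ t τ`: started in state `σ`, the program `p` halts in state `τ` after exactly `t`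
steps, where every elementary instruction and every test of a conditional or a loop is one step
(uniform cost). -/
inductive RAMRun : RAMProg → RAMState → ℕ → RAMState → Prop
  | skip (σ : RAMState) : RAMRun .skip σ 1 σ
  | const (σ : RAMState) (r c : ℕ) :
      RAMRun (.const r c) σ 1 ⟨Function.update σ.reg r c, σ.mem⟩
  | add (σ : RAMState) (r s t : ℕ) :
      RAMRun (.add r s t) σ 1 ⟨Function.update σ.reg r (σ.reg s + σ.reg t), σ.mem⟩
  | sub (σ : RAMState) (r s t : ℕ) :
      RAMRun (.sub r s t) σ 1 ⟨Function.update σ.reg r (σ.reg s - σ.reg t), σ.mem⟩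
  | load (σ : RAMState) (r s : ℕ) :
      RAMRun (.load r s) σ 1 ⟨Function.update σ.reg r (σ.mem (σ.reg s)), σ.mem⟩
  | store (σ : RAMState) (r s : ℕ) :
      RAMRun (.store r s) σ 1 ⟨σ.reg, Function.update σ.mem (σ.reg r) (σ.reg s)⟩
  | seq {p q : RAMProg} {σ₁ σ₂ σ₃ : RAMState} {t₁ t₂ : ℕ} :
      RAMRun p σ₁ t₁ σ₂ → RAMRun q σ₂ t₂ σ₃ → RAMRun (.seq p q) σ₁ (t₁ + t₂) σ₃
  | ite_true {r : ℕ} {p q : RAMProg} {σ τ : RAMState} {t : ℕ} :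
      σ.reg r ≠ 0 → RAMRun p σ t τ → RAMRun (.ite r p q) σ (t + 1) τ
  | ite_false {r : ℕ} {p q : RAMProg} {σ τ : RAMState} {t : ℕ} :
      σ.reg r = 0 → RAMRun q σ t τ → RAMRun (.ite r p q) σ (t + 1) τ
  | while_done {r : ℕ} {p : RAMProg} {σ : RAMState} :
      σ.reg r = 0 → RAMRun (.while r p) σ 1 σ
  | while_step {r : ℕ} {p : RAMProg} {σ₁ σ₂ σ₃ : RAMState} {t₁ t₂ : ℕ} :
      σ₁.reg r ≠ 0 → RAMRun p σ₁ t₁ σ₂ → RAMRun (.while r p) σ₂ t₂ σ₃ →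
        RAMRun (.while r p) σ₁ (t₁ + t₂ + 1) σ₃

/-- The input `x` stands in the memory cells `0, …, x.length - 1`; everything else is `0`. -/
def RAMState.start (x : List ℕ) : RAMState where
  reg := fun _ => 0
  mem := fun i => x.getD i 0

open Classical in
/-- On input `x` the program `p` halts within `T` steps and answers correctly whether `P` holds:
the final content of register `0` is `1` if `P` holds and `0` if not. -/
def RAMProg.DecidesWithin (p : RAMProg) (x : List ℕ) (P : Prop) (T : ℕ) : Prop :=
  ∃ (t : ℕ) (τ : RAMState), RAMRun p (RAMState.start x) t τ ∧ t ≤ T ∧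
    τ.reg 0 = if P then 1 else 0

/-- The size of an input: its numbers are counted with their binary lengths. -/
def inputSize (x : List ℕ) : ℕ := (x.map fun a => a.size + 1).sum

/-- A parameterized decision problem: instances with their encodings as inputs, the parameter
of each instance, and the yes-instances. -/
structure ParamProblem where
  Inst : Type
  encode : Inst → List ℕ
  param : Inst → ℕ
  yes : Inst → Prop

/-- Fixed-parameter tractability: one algorithm decides all instances `I` in time
`f (param I) * |I| ^ d` for a computable function `f` and a constant `d`. -/
def ParamProblem.IsFPT (Q : ParamProblem) : Prop :=
  ∃ (p : RAMProg) (f : ℕ → ℕ) (d : ℕ), Computable f ∧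
    ∀ I : Q.Inst, p.DecidesWithin (Q.encode I) (Q.yes I) (f (Q.param I) * inputSize (Q.encode I) ^ d)

/-- A network with `n ≥ 1` users and `k` channels whose potential graph is complete. -/
structure CompleteCRN where
  n : ℕ
  k : ℕ
  net : CRN (Fin n) (Fin k)
  n_pos : 1 ≤ n
  complete : net.graph = ⊤

/-- The connectability problem for networks with a complete potential graph, parameterized by the
number of channels. -/
noncomputable def spectrumConnectivityComplete : ParamProblem where
  Inst := CompleteCRN
  encode := fun I => I.net.encode
  param := fun I => I.k
  yes := fun I => I.net.Connectable

/-! ### Total correctness with a time bound -/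

/-! In a complete potential graph, two distinct users are adjacent in the realization graph exactly
when they open a common channel. Hence, for at least two users, the graph is connected iff every
user opens some channel and no set `X` of channels separates: if channels inside and outside `X` are
opened, some user opens both kinds (`connected_realizationGraph_iff`). Given nonemptiness, this
depends only on the family `F` of channel sets in use, and there are `2 ^ 2 ^ k` families.

The families arising from the first `u` users satisfy a recursion (`reachable_iff`): the last user
takes some `S ∈ F`, and the earlier users realize `F` or `F` without `S`. A family is coded as a
number whose binary digits mark its members, so removing `S` is subtracting `2 ^ S`. Rows `0` to `n`
of a table follow this recursion; row `n + 1` records whether some reachable inseparable family is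
coded by a number up to `F`, so its last entry is the answer (`Stored.connectable_iff`). Each entry
depends only on entries of smaller index (`holds_entryExpr`), and one loop fills the table.

For the running time, entries are written in an expression language whose loops run only to `n`, `k`
or `2 ^ k`. Compilation preserves values (`halts_compile`), and the cost of an expression is
polynomial in `n * 2 ^ k` (`polyBounded_cost`). Multiplying by the `(n + 2) * 2 ^ 2 ^ k` entries
gives (1) (`exists_decider_time_le`); (2) follows because `n` is at most the input size. -/

/-- Started in `σ`, the program `p` halts within `T` steps in a state satisfying `Q`. -/
def RAMProg.Halts (p : RAMProg) (σ : RAMState) (T : ℕ) (Q : RAMState → Prop) : Prop :=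
  ∃ (t : ℕ) (τ : RAMState), RAMRun p σ t τ ∧ t ≤ T ∧ Q τ

namespace RAMProg

variable {p q : RAMProg} {σ : RAMState} {T T' : ℕ} {Q Q' : RAMState → Prop}

theorem Halts.mono (h : p.Halts σ T Q) (hT : T ≤ T') (hQ : ∀ τ, Q τ → Q' τ) :
    p.Halts σ T' Q' := by
  obtain ⟨t, τ, h1, h2, h3⟩ := h
  exact ⟨t, τ, h1, h2.trans hT, hQ _ h3⟩

theorem Halts.seq (h : p.Halts σ T fun τ => q.Halts τ T' Q) : (p.seq q).Halts σ (T + T') Q := by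
  obtain ⟨t, τ, h1, h2, t', τ', h3, h4, h5⟩ := h
  exact ⟨_, _, .seq h1 h3, by omega, h5⟩

theorem halts_const {r c : ℕ} (h : Q ⟨Function.update σ.reg r c, σ.mem⟩) :
    (RAMProg.const r c).Halts σ 1 Q :=
  ⟨_, _, .const _ _ _, le_rfl, h⟩

theorem halts_add {r s t : ℕ} (h : Q ⟨Function.update σ.reg r (σ.reg s + σ.reg t), σ.mem⟩) :
    (RAMProg.add r s t).Halts σ 1 Q :=
  ⟨_, _, .add _ _ _ _, le_rfl, h⟩

theorem halts_sub {r s t : ℕ} (h : Q ⟨Function.update σ.reg r (σ.reg s - σ.reg t), σ.mem⟩) :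
    (RAMProg.sub r s t).Halts σ 1 Q :=
  ⟨_, _, .sub _ _ _ _, le_rfl, h⟩

theorem halts_load {r s : ℕ} (h : Q ⟨Function.update σ.reg r (σ.mem (σ.reg s)), σ.mem⟩) :
    (RAMProg.load r s).Halts σ 1 Q :=
  ⟨_, _, .load _ _ _, le_rfl, h⟩

theorem halts_store {r s : ℕ} (h : Q ⟨σ.reg, Function.update σ.mem (σ.reg r) (σ.reg s)⟩) :
    (RAMProg.store r s).Halts σ 1 Q :=
  ⟨_, _, .store _ _ _, le_rfl, h⟩

theorem halts_ite {r : ℕ} (hp : σ.reg r ≠ 0 → p.Halts σ T Q) (hq : σ.reg r = 0 → q.Halts σ T Q) :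
    (RAMProg.ite r p q).Halts σ (T + 1) Q := by
  by_cases h : σ.reg r = 0
  · obtain ⟨t, τ, h1, h2, h3⟩ := hq h
    exact ⟨_, _, .ite_false h h1, by omega, h3⟩
  · obtain ⟨t, τ, h1, h2, h3⟩ := hp h
    exact ⟨_, _, .ite_true h h1, by omega, h3⟩

/-- The loop rule for a loop with invariant `I` and exactly `N` rounds. -/
theorem halts_while {r N : ℕ} (I : ℕ → RAMState → Prop)
    (hstep : ∀ i < N, ∀ σ, I i σ → σ.reg r ≠ 0 ∧ p.Halts σ T (I (i + 1)))
    (hend : ∀ σ, I N σ → σ.reg r = 0) (h0 : I 0 σ) :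
    (RAMProg.while r p).Halts σ (N * (T + 1) + 1) (I N) := by
  suffices H : ∀ m i σ, i + m = N → I i σ → (RAMProg.while r p).Halts σ (m * (T + 1) + 1) (I N) from
    H N 0 σ (by omega) h0
  intro m
  induction m with
  | zero =>
    intro i σ hi h
    obtain rfl : i = N := by omega
    exact ⟨1, σ, .while_done (hend _ h), by omega, h⟩
  | succ m ih =>
    intro i σ hi h
    obtain ⟨hr, t, τ, h1, h2, h3⟩ := hstep i (by omega) σ h
    obtain ⟨t', τ', h1', h2', h3'⟩ := ih (i + 1) τ (by omega) h3
    refine ⟨_, _, .while_step hr h1 h1', ?_, h3'⟩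
    rw [Nat.succ_mul]
    omega

end RAMProg

/-! ### An expression language with bounded loops and its compilation -/

/-- Expressions over the global registers `0, …, 7`, a stack of local variables and read access to
the memory. Loops run over the numbers below one of the first three global registers. -/
inductive RAMExpr : Type
  /-- the `i`-th local variable, counted from the innermost binder -/
  | var (i : ℕ) : RAMExpr
  /-- a global register -/
  | glob (j : Fin 8) : RAMExpr
  | const (c : ℕ) : RAMExpr
  | add (a b : RAMExpr) : RAMExpr
  | sub (a b : RAMExpr) : RAMExpr
  /-- the memory cell with address `a` -/
  | load (a : RAMExpr) : RAMExpr
  /-- `a` if `c ≠ 0`, and `b` otherwise -/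
  | ite (c a b : RAMExpr) : RAMExpr
  /-- `b` with the value of `a` as new innermost local variable -/
  | bind (a b : RAMExpr) : RAMExpr
  /-- iterate `b`, starting with `a`; in `b` the local variable `0` is the value so far and the
  local variable `1` the number of the round -/
  | fold (j : Fin 3) (a b : RAMExpr) : RAMExpr

namespace RAMExpr

open RAMProg

/-- The environment `env` with a new innermost variable. -/
def push (v : ℕ) (env : ℕ → ℕ) : ℕ → ℕ
  | 0 => v
  | i + 1 => env i

@[simp] theorem push_zero (v : ℕ) (env : ℕ → ℕ) : push v env 0 = v := rfl
@[simp] theorem push_succ (v : ℕ) (env : ℕ → ℕ) (i : ℕ) : push v env (i + 1) = env i := rfl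

/-- `n` rounds of the iteration `x ↦ f i x` from `a`, where `i` is the number of the round. -/
def iter (f : ℕ → ℕ → ℕ) (a : ℕ) : ℕ → ℕ
  | 0 => a
  | i + 1 => f i (iter f a i)

/-- The value of an expression. -/
def eval (γ μ : ℕ → ℕ) : RAMExpr → (ℕ → ℕ) → ℕ
  | var i, env => env i
  | glob j, _ => γ j
  | const c, _ => c
  | add a b, env => eval γ μ a env + eval γ μ b env
  | sub a b, env => eval γ μ a env - eval γ μ b env
  | load a, env => μ (eval γ μ a env)
  | ite c a b, env => if eval γ μ c env ≠ 0 then eval γ μ a env else eval γ μ b env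
  | bind a b, env => eval γ μ b (push (eval γ μ a env) env)
  | fold j a b, env =>
      iter (fun i x => eval γ μ b (push x (push i env))) (eval γ μ a env) (γ j)

/-- The program that writes the value of an expression into register `d` and changes no register
below `d`; the local variable `i` is in register `ρ i`. -/
def compile : RAMExpr → (ℕ → ℕ) → ℕ → RAMProg
  | var i, ρ, d => .seq (.const d 0) (.add d d (ρ i))
  | glob j, _, d => .seq (.const d 0) (.add d d j)
  | const c, _, d => .const d c
  | add a b, ρ, d => .seq (compile a ρ d) (.seq (compile b ρ (d + 1)) (.add d d (d + 1)))
  | sub a b, ρ, d => .seq (compile a ρ d) (.seq (compile b ρ (d + 1)) (.sub d d (d + 1)))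
  | load a, ρ, d => .seq (compile a ρ d) (.load d d)
  | ite c a b, ρ, d => .seq (compile c ρ d) (.ite d (compile a ρ d) (compile b ρ d))
  | bind a b, ρ, d =>
      .seq (compile a ρ d) (.seq (compile b (push d ρ) (d + 1))
        (.seq (.const d 0) (.add d d (d + 1))))
  | fold j a b, ρ, d =>
      .seq (compile a ρ d) (.seq (.const (d + 1) 0) (.seq (.const (d + 2) 0)
        (.seq (.add (d + 2) (d + 2) j) (.seq (.const (d + 3) 1)
        (.while (d + 2) (.seq (compile b (push d (push (d + 1) ρ)) (d + 4))
          (.seq (.sub (d + 2) (d + 2) (d + 3)) (.seq (.add (d + 1) (d + 1) (d + 3))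
            (.seq (.const d 0) (.add d d (d + 4)))))))))))

/-- A bound for the running time of a compiled expression whose loops have at most `B` rounds. -/
def cost (B : ℕ) : RAMExpr → ℕ
  | var _ => 2
  | glob _ => 2
  | const _ => 1
  | add a b => cost B a + (cost B b + 1)
  | sub a b => cost B a + (cost B b + 1)
  | load a => cost B a + 1
  | ite c a b => cost B c + (cost B a + cost B b + 1)
  | bind a b => cost B a + (cost B b + 2)
  | fold _ a b => cost B a + (B * (cost B b + 5) + 5)

/-! ### Cost and correctness of compiled expressions -/

/-- The function `f` is bounded by a polynomial on the positive integers. -/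
def PolyBounded (f : ℕ → ℕ) : Prop := ∃ c m : ℕ, ∀ B, 1 ≤ B → f B ≤ c * B ^ m

theorem polyBounded_const (l : ℕ) : PolyBounded fun _ => l := ⟨l, 0, by simp⟩

theorem polyBounded_id : PolyBounded fun B => B := ⟨1, 1, by simp⟩

theorem PolyBounded.add {f g : ℕ → ℕ} (hf : PolyBounded f) (hg : PolyBounded g) :
    PolyBounded fun B => f B + g B := by
  obtain ⟨c, m, h⟩ := hf
  obtain ⟨c', m', h'⟩ := hg
  refine ⟨c + c', m + m', fun B hB => ?_⟩
  have h1 : B ^ m ≤ B ^ (m + m') := Nat.pow_le_pow_right hB (by omega)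
  have h2 : B ^ m' ≤ B ^ (m + m') := Nat.pow_le_pow_right hB (by omega)
  calc f B + g B ≤ c * B ^ m + c' * B ^ m' := Nat.add_le_add (h B hB) (h' B hB)
    _ ≤ c * B ^ (m + m') + c' * B ^ (m + m') := by gcongr
    _ = _ := by ring

theorem PolyBounded.mul {f g : ℕ → ℕ} (hf : PolyBounded f) (hg : PolyBounded g) :
    PolyBounded fun B => f B * g B := by
  obtain ⟨c, m, h⟩ := hf
  obtain ⟨c', m', h'⟩ := hg
  refine ⟨c * c', m + m', fun B hB => ?_⟩
  calc f B * g B ≤ c * B ^ m * (c' * B ^ m') := Nat.mul_le_mul (h B hB) (h' B hB)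
    _ = _ := by ring

/-- Each `fold` contributes one factor `B`, and the nesting depth is fixed by the expression, so the
degree does not depend on the input. -/
theorem polyBounded_cost (e : RAMExpr) : PolyBounded fun B => cost B e := by
  induction e with
  | var i => exact polyBounded_const 2
  | glob j => exact polyBounded_const 2
  | const c => exact polyBounded_const 1
  | add a b iha ihb => exact iha.add (ihb.add (polyBounded_const 1))
  | sub a b iha ihb => exact iha.add (ihb.add (polyBounded_const 1))
  | load a iha => exact iha.add (polyBounded_const 1)
  | ite c a b ihc iha ihb => exact ihc.add ((iha.add ihb).add (polyBounded_const 1))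
  | bind a b iha ihb => exact iha.add (ihb.add (polyBounded_const 2))
  | fold j a b iha ihb =>
    exact iha.add ((polyBounded_id.mul (ihb.add (polyBounded_const 5))).add (polyBounded_const 5))

/-- Registers are used as a stack: code compiled at `d` writes only to registers from `d` on, so the
globals, the local variables and pending intermediate results below `d` survive. Loop bounds are
globals, hence constant during the evaluation. -/
theorem halts_compile {B : ℕ} {γ : ℕ → ℕ} (hB : ∀ j < 3, γ j ≤ B) (e : RAMExpr) :
    ∀ (ρ env : ℕ → ℕ) (d : ℕ) (σ : RAMState), 8 ≤ d → (∀ j < 8, σ.reg j = γ j) →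
      (∀ i, ρ i < d ∧ σ.reg (ρ i) = env i) →
      (compile e ρ d).Halts σ (cost B e) fun τ =>
        τ.mem = σ.mem ∧ (∀ r < d, τ.reg r = σ.reg r) ∧ τ.reg d = eval γ σ.mem e env := by
  induction e with
  | var i =>
    intro ρ env d σ hd hγ hρ
    have h1 := hρ i
    refine Halts.seq (T := 1) (T' := 1) (halts_const (halts_add ⟨rfl, ?_, ?_⟩))
    · intro r hr
      simp [Function.update, hr.ne]
    · simp [Function.update, h1.1.ne, h1.2, eval]
  | glob j =>
    intro ρ env d σ hd hγ hρ
    have h1 : (j : ℕ) ≠ d := by have := j.2; omega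
    refine Halts.seq (T := 1) (T' := 1) (halts_const (halts_add ⟨rfl, ?_, ?_⟩))
    · intro r hr
      simp [Function.update, hr.ne]
    · simp [Function.update, h1, eval, hγ j j.2]
  | const c =>
    intro ρ env d σ hd hγ hρ
    refine halts_const ⟨rfl, fun r hr => ?_, ?_⟩
    · simp [Function.update, hr.ne]
    · simp [eval]
  | add a b iha ihb =>
    intro ρ env d σ hd hγ hρ
    refine Halts.seq ((iha ρ env d σ hd hγ hρ).mono le_rfl ?_)
    rintro τ ⟨h1, h2, h3⟩
    refine Halts.seq ((ihb ρ env (d + 1) τ (by omega) (fun j hj => ?_) (fun i => ?_)).mono le_rfl ?_)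
    · rw [h2 j (by omega), hγ j hj]
    · exact ⟨(hρ i).1.trans (by omega), by rw [h2 _ (hρ i).1, (hρ i).2]⟩
    rintro τ' ⟨h4, h5, h6⟩
    refine halts_add ⟨by simp [h4, h1], fun r hr => ?_, ?_⟩
    · simp [Function.update, hr.ne, h5 r (by omega), h2 r hr]
    · simp [h5 d (by omega), h3, h6, eval, h1]
  | sub a b iha ihb =>
    intro ρ env d σ hd hγ hρ
    refine Halts.seq ((iha ρ env d σ hd hγ hρ).mono le_rfl ?_)
    rintro τ ⟨h1, h2, h3⟩
    refine Halts.seq ((ihb ρ env (d + 1) τ (by omega) (fun j hj => ?_) (fun i => ?_)).mono le_rfl ?_)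
    · rw [h2 j (by omega), hγ j hj]
    · exact ⟨(hρ i).1.trans (by omega), by rw [h2 _ (hρ i).1, (hρ i).2]⟩
    rintro τ' ⟨h4, h5, h6⟩
    refine halts_sub ⟨by simp [h4, h1], fun r hr => ?_, ?_⟩
    · simp [Function.update, hr.ne, h5 r (by omega), h2 r hr]
    · simp [h5 d (by omega), h3, h6, eval, h1]
  | load a iha =>
    intro ρ env d σ hd hγ hρ
    refine Halts.seq ((iha ρ env d σ hd hγ hρ).mono le_rfl ?_)
    rintro τ ⟨h1, h2, h3⟩
    refine halts_load ⟨h1, fun r hr => ?_, ?_⟩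
    · simp [Function.update, hr.ne, h2 r hr]
    · simp [h3, h1, eval]
  | ite c a b ihc iha ihb =>
    intro ρ env d σ hd hγ hρ
    refine Halts.seq ((ihc ρ env d σ hd hγ hρ).mono le_rfl ?_)
    rintro τ ⟨h1, h2, h3⟩
    have hγ' : ∀ j < 8, τ.reg j = γ j := fun j hj => by rw [h2 j (by omega), hγ j hj]
    have hρ' : ∀ i, ρ i < d ∧ τ.reg (ρ i) = env i := fun i =>
      ⟨(hρ i).1, by rw [h2 _ (hρ i).1, (hρ i).2]⟩
    refine halts_ite (fun hc => ?_) (fun hc => ?_)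
    · refine (iha ρ env d τ hd hγ' hρ').mono (by omega) ?_
      rintro τ' ⟨h4, h5, h6⟩
      refine ⟨h4.trans h1, fun r hr => (h5 r hr).trans (h2 r hr), ?_⟩
      rw [h3] at hc
      simp [eval, h6, h1, hc]
    · refine (ihb ρ env d τ hd hγ' hρ').mono (by omega) ?_
      rintro τ' ⟨h4, h5, h6⟩
      refine ⟨h4.trans h1, fun r hr => (h5 r hr).trans (h2 r hr), ?_⟩
      rw [h3] at hc
      simp [eval, h6, h1, hc]
  | bind a b iha ihb =>
    intro ρ env d σ hd hγ hρ
    refine Halts.seq ((iha ρ env d σ hd hγ hρ).mono le_rfl ?_)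
    rintro τ ⟨h1, h2, h3⟩
    refine Halts.seq ((ihb (push d ρ) (push (eval γ σ.mem a env) env) (d + 1) τ (by omega)
      (fun j hj => ?_) (fun i => ?_)).mono le_rfl ?_)
    · rw [h2 j (by omega), hγ j hj]
    · cases i with
      | zero => exact ⟨Nat.lt_succ_self d, h3⟩
      | succ i => exact ⟨(hρ i).1.trans (by omega), (h2 _ (hρ i).1).trans (hρ i).2⟩
    rintro τ' ⟨h4, h5, h6⟩
    refine Halts.seq (T := 1) (T' := 1) (halts_const (halts_add ⟨h4.trans h1, fun r hr => ?_, ?_⟩))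
    · simp [Function.update, hr.ne, h5 r (by omega), h2 r hr]
    · simp [h6, eval, h1]
  | fold j a b iha ihb =>
    intro ρ env d σ hd hγ hρ
    refine Halts.seq ((iha ρ env d σ hd hγ hρ).mono le_rfl ?_)
    rintro τ ⟨h1, h2, h3⟩
    have hj : (j : ℕ) < 8 := by have := j.2; omega
    have hjγ := hγ j hj
    -- Register `d` holds the running value, `d + 1` the round number, `d + 2` the rounds left and
    -- `d + 3` the constant `1`; the body works from `d + 4` on. A round costs four instructions and
    -- one test beyond the body.
    refine (Halts.seq (T := 1) (T' := 1 + (1 + (1 + (γ j * (cost B b + 5) + 1)))) (halts_const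
      (Halts.seq (halts_const (Halts.seq (halts_add (Halts.seq (halts_const
        ((halts_while (N := γ j) (T := cost B b + 4) (fun i τ => τ.mem = σ.mem ∧
        (∀ r < d, τ.reg r = σ.reg r) ∧ τ.reg d =
          iter (fun i x => eval γ σ.mem b (push x (push i env))) (eval γ σ.mem a env) i ∧
          τ.reg (d + 1) = i ∧ τ.reg (d + 2) = γ j - i ∧ τ.reg (d + 3) = 1) ?_ ?_ ?_).mono
            le_rfl ?_))))))))).mono ?_ (fun _ h => h)
    · rintro i hi τ ⟨g1, g2, g3, g4, g5, g6⟩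
      refine ⟨by omega, Halts.seq (T' := 1 + (1 + (1 + 1))) ((ihb (push d (push (d + 1) ρ))
        (push (τ.reg d) (push i env)) (d + 4) τ (by omega)
        (fun j h => by rw [g2 j (by omega), hγ j h]) (fun l => ?_)).mono le_rfl ?_)⟩
      · match l with
        | 0 => exact ⟨by simp, rfl⟩
        | 1 => exact ⟨by simp [push], g4⟩
        | l + 2 => exact ⟨(hρ l).1.trans (by omega), (g2 _ (hρ l).1).trans (hρ l).2⟩
      rintro τ' ⟨f1, f2, f3⟩
      refine Halts.seq (halts_sub (Halts.seq (halts_add (Halts.seq (halts_const (halts_add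
        ⟨f1.trans g1, ?_, ?_, ?_, ?_, ?_⟩))))))
      · intro r hr
        have a1 : r ≠ d := by omega
        have a2 : r ≠ d + 1 := by omega
        have a3 : r ≠ d + 2 := by omega
        simp [Function.update, a1, a2, a3, f2 r (by omega), g2 r hr]
      · simp [Function.update, f3, g1, iter, g3]
      · simp [Function.update, f2, g4, g6]
      · simp [Function.update, f2, g5, g6]
        omega
      · simp [Function.update, f2, g6]
    · rintro τ ⟨g1, g2, g3, g4, g5, g6⟩
      omega
    · refine ⟨h1, ?_, ?_, ?_, ?_, ?_⟩
      · intro r hr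
        have a1 : r ≠ d + 3 := by omega
        have a2 : r ≠ d + 1 := by omega
        have a3 : r ≠ d + 2 := by omega
        simp [Function.update, a1, a2, a3, h2 r hr]
      · simp [Function.update, h3, iter]
      · simp [Function.update]
      · have a1 : (j : ℕ) ≠ d + 1 := by omega
        have a2 : (j : ℕ) ≠ d + 2 := by omega
        simp [Function.update, a1, a2, h2 j (by omega), hjγ]
      · simp
    · rintro τ ⟨g1, g2, g3, -⟩
      exact ⟨g1, g2, g3⟩
    · have := Nat.mul_le_mul_right (cost B b + 5) (hB j j.2)
      omega

/-- The program that writes the value of an expression into the global register `j`. -/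
def assign (j : ℕ) (e : RAMExpr) : RAMProg :=
  .seq (compile e (fun _ => 0) 8) (.seq (.const 9 0) (.add j 8 9))

/-- Only the globals are tracked; the working registers from `8` on may be left in any state.
Mapping every local variable to register `0` is an arbitrary choice of outer environment. -/
theorem halts_assign {B : ℕ} {σ : RAMState} (hB : ∀ j < 3, σ.reg j ≤ B) (j : ℕ)
    (e : RAMExpr) :
    (assign j e).Halts σ (cost B e + 2) fun τ =>
      τ.mem = σ.mem ∧ ∀ r < 8, τ.reg r =
        Function.update σ.reg j (eval σ.reg σ.mem e fun _ => σ.reg 0) r := by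
  refine Halts.seq (T' := 1 + 1) ((halts_compile hB e (fun _ => 0) (fun _ => σ.reg 0) 8 σ le_rfl
    (fun _ _ => rfl) fun _ => ⟨by norm_num, rfl⟩).mono le_rfl ?_)
  rintro τ ⟨h1, h2, h3⟩
  refine Halts.seq (halts_const (halts_add ⟨h1, fun r hr => ?_⟩))
  have a1 : r ≠ 9 := by omega
  by_cases h : r = j <;> simp [Function.update, h, h3, h2 r hr, a1]

end RAMExpr

namespace RAMExpr

variable {γ μ env : ℕ → ℕ}

/-! ### Boolean operations, where nonzero numbers stand for truth -/

/-- `a ≤ b` -/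
def le (a b : RAMExpr) : RAMExpr := ite (sub a b) (const 0) (const 1)
def not (a : RAMExpr) : RAMExpr := ite a (const 0) (const 1)
def and (a b : RAMExpr) : RAMExpr := ite a b (const 0)
def or (a b : RAMExpr) : RAMExpr := ite a (const 1) b
/-- `b` holds in some round; in `b` the local variable `1` is the number of the round. -/
def any (j : Fin 3) (b : RAMExpr) : RAMExpr := fold j (const 0) (ite (var 0) (const 1) b)

/-- The expression `a` holds. -/
def Holds (γ μ : ℕ → ℕ) (a : RAMExpr) (env : ℕ → ℕ) : Prop := eval γ μ a env ≠ 0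

instance (a : RAMExpr) : Decidable (Holds γ μ a env) :=
  inferInstanceAs (Decidable (eval γ μ a env ≠ 0))

theorem eval_add {a b : RAMExpr} :
    eval γ μ (add a b) env = eval γ μ a env + eval γ μ b env := rfl

theorem eval_ite {a b c : RAMExpr} :
    eval γ μ (ite c a b) env =
      if Holds γ μ c env then eval γ μ a env else eval γ μ b env := rfl

theorem eval_bind {a b : RAMExpr} :
    eval γ μ (bind a b) env = eval γ μ b (push (eval γ μ a env) env) := rfl

theorem holds_ite {a b c : RAMExpr} :
    Holds γ μ (ite c a b) env ↔
      (Holds γ μ c env ∧ Holds γ μ a env) ∨ (¬ Holds γ μ c env ∧ Holds γ μ b env) := by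
  rw [Holds, eval_ite]
  split_ifs with h <;> simp only [h, true_and, false_and, not_true, not_false_iff, or_false,
    false_or] <;> rfl

theorem holds_le {a b : RAMExpr} :
    Holds γ μ (le a b) env ↔ eval γ μ a env ≤ eval γ μ b env := by
  by_cases h : eval γ μ a env - eval γ μ b env = 0 <;> simp [Holds, le, eval, h] <;> omega

theorem holds_not {a : RAMExpr} : Holds γ μ (not a) env ↔ ¬ Holds γ μ a env := by
  simp [not, Holds, eval]

theorem holds_and {a b : RAMExpr} :
    Holds γ μ (and a b) env ↔ Holds γ μ a env ∧ Holds γ μ b env := by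
  simp [and, Holds, eval]

theorem holds_or {a b : RAMExpr} :
    Holds γ μ (or a b) env ↔ Holds γ μ a env ∨ Holds γ μ b env := by
  simp only [or, holds_ite]
  simp [Holds, eval]
  tauto

theorem holds_bind {a b : RAMExpr} :
    Holds γ μ (bind a b) env ↔ Holds γ μ b (push (eval γ μ a env) env) := Iff.rfl

theorem holds_var {i : ℕ} : Holds γ μ (var i) env ↔ env i ≠ 0 := Iff.rfl

theorem holds_load {a : RAMExpr} : Holds γ μ (load a) env ↔ μ (eval γ μ a env) ≠ 0 := Iff.rfl

/-- Once a round succeeds the accumulator stays nonzero, so `b` is only ever evaluated while the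
accumulator is `0`; hence the `push 0`. -/
theorem holds_any {j : Fin 3} {b : RAMExpr} :
    Holds γ μ (any j b) env ↔ ∃ i < γ j, Holds γ μ b (push 0 (push i env)) := by
  suffices H : ∀ N, iter (fun i x => eval γ μ (ite (var 0) (const 1) b) (push x (push i env))) 0 N
      ≠ 0 ↔ ∃ i < N, Holds γ μ b (push 0 (push i env)) from H (γ j)
  intro N
  induction N with
  | zero => simp [iter]
  | succ N ih =>
    rw [iter, Nat.exists_lt_succ_right, ← ih]
    generalize iter _ 0 N = v
    by_cases hv : v = 0 <;> simp [eval, hv, Holds]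

theorem iter_congr {f g : ℕ → ℕ → ℕ} (h : ∀ i x, f i x = g i x) (a N : ℕ) :
    iter f a N = iter g a N := by
  have : f = g := funext₂ h
  rw [this]

/-! ### Arithmetic -/

/-- The local variable `a` times the loop bound `j`. -/
def times (j : Fin 3) (a : ℕ) : RAMExpr := fold j (const 0) (add (var 0) (var (a + 2)))

theorem eval_times {j : Fin 3} {a : ℕ} : eval γ μ (times j a) env = γ j * env a := by
  suffices H : ∀ N, iter (fun _ x => x + env a) 0 N = N * env a from H (γ j)
  intro N
  induction N with
  | zero => simp [iter]
  | succ N ih => rw [iter, ih, Nat.succ_mul]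

/-- The local variable `a` times `v`, where `a` is at most the loop bound `j`. -/
def mul (j : Fin 3) (a : ℕ) (v : Fin 8) : RAMExpr :=
  fold j (const 0) (ite (sub (var (a + 2)) (var 1)) (add (var 0) (glob v)) (var 0))

theorem eval_mul {j : Fin 3} {a : ℕ} {v : Fin 8} (ha : env a ≤ γ j) :
    eval γ μ (mul j a v) env = env a * γ v := by
  suffices H : ∀ N, iter (fun i x => if env a - i ≠ 0 then x + γ v else x) 0 N
      = min (env a) N * γ v by
    have := H (γ j)
    rwa [min_eq_left ha] at this
  intro N
  induction N with
  | zero => simp [iter]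
  | succ N ih =>
    rw [iter, ih]
    split_ifs with h
    · rw [min_eq_right (by omega), min_eq_right (by omega), Nat.succ_mul]
    · rw [min_eq_left (by omega), min_eq_left (by omega)]

/-- Two to the power of the local variable `a`, or of the loop bound `j` if that is smaller. -/
def twoPow (j : Fin 3) (a : ℕ) : RAMExpr :=
  fold j (const 1) (ite (sub (var (a + 2)) (var 1)) (add (var 0) (var 0)) (var 0))

theorem eval_twoPow {j : Fin 3} {a : ℕ} :
    eval γ μ (twoPow j a) env = 2 ^ min (env a) (γ j) := by
  suffices H : ∀ N, iter (fun i x => if env a - i ≠ 0 then x + x else x) 1 N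
      = 2 ^ min (env a) N from H (γ j)
  intro N
  induction N with
  | zero => simp [iter]
  | succ N ih =>
    rw [iter, ih]
    split_ifs with h
    · rw [min_eq_right (by omega), min_eq_right (by omega)]
      ring
    · rw [min_eq_left (by omega), min_eq_left (by omega)]

/-! ### Binary digits -/

theorem mod_two_pow_succ (x i : ℕ) :
    x % 2 ^ (i + 1) = x % 2 ^ i + 2 ^ i * (x.testBit i).toNat := by
  rw [Nat.mod_pow_succ, Nat.testBit_eq_decide_div_mod_eq]
  rcases Nat.mod_two_eq_zero_or_one (x / 2 ^ i) with h | h <;> simp [h]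

/-- The lowest `a + 1` binary digits of the local variable `x`, which has at most as many digits
as the loop bound `j` says. -/
def lowBits (j : Fin 3) (x a : ℕ) : RAMExpr :=
  fold j (var x) (bind (sub (sub (glob (j.castLE (by norm_num))) (const 1)) (var 1))
    (bind (twoPow j 0) (ite (and (le (add (var (a + 4)) (const 1)) (var 1)) (le (var 0) (var 2)))
      (sub (var 2) (var 0)) (var 2))))

/-- Without division, digits are cleared from the top: round `t` treats position `γ j - 1 - t`,
where comparison with the power of two reveals the leading digit. Positions up to `env a` are
spared, which gives the `max` in the invariant. -/
theorem eval_lowBits {j : Fin 3} {x a : ℕ} (hx : env x < 2 ^ γ j) :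
    eval γ μ (lowBits j x a) env = env x % 2 ^ (env a + 1) := by
  classical
  set f : ℕ → ℕ → ℕ := fun t y => eval γ μ (bind (sub (sub (glob (j.castLE (by norm_num)))
    (const 1)) (var 1)) (bind (twoPow j 0) (ite (and (le (add (var (a + 4)) (const 1)) (var 1))
      (le (var 0) (var 2))) (sub (var 2) (var 0)) (var 2)))) (push y (push t env)) with hf
  have hfv : ∀ t y, f t y = if env a + 1 ≤ γ j - 1 - t ∧ 2 ^ (γ j - 1 - t) ≤ y
      then y - 2 ^ (γ j - 1 - t) else y := by
    intro t y
    have h : min (γ j - 1 - t) (γ j) = γ j - 1 - t := by omega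
    rw [hf]
    dsimp only
    rw [eval_bind, eval_bind, eval_ite]
    simp [holds_and, holds_le, eval_twoPow, eval, h]
  suffices H : ∀ t ≤ γ j, iter f (env x) t = env x % 2 ^ max (γ j - t) (env a + 1) by
    have := H (γ j) le_rfl
    rw [Nat.sub_self, Nat.max_eq_right (by omega)] at this
    exact this
  intro t
  induction t with
  | zero =>
    intro _
    rw [iter, Nat.mod_eq_of_lt (hx.trans_le (Nat.pow_le_pow_right (by norm_num) (by simp)))]
  | succ t ih =>
    intro ht
    rw [iter, ih (by omega), hfv]
    obtain ⟨i, hi⟩ : ∃ i, γ j = t + 1 + i := ⟨γ j - (t + 1), by omega⟩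
    have e1 : γ j - 1 - t = i := by omega
    have e2 : γ j - t = i + 1 := by omega
    have e3 : γ j - (t + 1) = i := by omega
    rw [e1, e2, e3]
    by_cases h : env a + 1 ≤ i
    · rw [max_eq_left (by omega), max_eq_left h, mod_two_pow_succ]
      have h1 : env x % 2 ^ i < 2 ^ i := Nat.mod_lt _ (by positivity)
      cases hb : (env x).testBit i <;> (simp [h]; try omega)
    · rw [max_eq_right (by omega), max_eq_right (by omega)]
      simp [h]

/-- The binary digit of the local variable `x` at the position `a`. -/
def bit (j : Fin 3) (x a : ℕ) : RAMExpr :=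
  bind (lowBits j x a) (bind (twoPow j (a + 1)) (le (var 0) (var 1)))

theorem holds_bit {j : Fin 3} {x a : ℕ} (hx : env x < 2 ^ γ j) :
    Holds γ μ (bit j x a) env ↔ (env x).testBit (env a) = true := by
  simp only [bit, holds_bind, holds_le, eval, push_succ, push_zero, eval_twoPow, eval_lowBits hx]
  rcases le_total (env a) (γ j) with h | h
  · rw [min_eq_left h, mod_two_pow_succ]
    have h1 : env x % 2 ^ env a < 2 ^ env a := Nat.mod_lt _ (by positivity)
    cases hb : (env x).testBit (env a) <;> (simp; try omega)
  -- Here `twoPow` is capped at `2 ^ γ j`, but this still exceeds `env x`, so the comparison fails,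
  -- as it should for a digit beyond the length.
  · have h1 := hx.trans_le (Nat.pow_le_pow_right (n := 2) (by norm_num) h)
    rw [min_eq_right h, Nat.testBit_eq_false_of_lt h1]
    have := Nat.mod_le (env x) (2 ^ (env a + 1))
    simp
    omega

/-- The number of binary digits `1` of the local variable `x`. -/
def popcount (j : Fin 3) (x : ℕ) : RAMExpr :=
  fold j (const 0) (ite (bit j (x + 2) 1) (add (var 0) (const 1)) (var 0))

theorem eval_popcount {j : Fin 3} {x : ℕ} (hx : env x < 2 ^ γ j) :
    eval γ μ (popcount j x) env =
      ((Finset.range (γ j)).filter fun c => (env x).testBit c = true).card := by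
  classical
  have H : ∀ N, iter (fun i y => if (env x).testBit i = true then y + 1 else y) 0 N =
      ((Finset.range N).filter fun c => (env x).testBit c = true).card := by
    intro N
    induction N with
    | zero => simp [iter]
    | succ N ih =>
      rw [iter, ih, Finset.range_add_one, Finset.filter_insert]
      split_ifs <;> simp
  rw [← H]
  refine iter_congr (fun i y => ?_) _ _
  rw [eval_ite]
  have h := holds_bit (γ := γ) (μ := μ) (env := push y (push i env)) (j := j) (x := x + 2)
    (a := 1) hx
  simp only [h, eval]
  rfl

end RAMExpr

/-! ### The dynamic program

A set of channels is represented by a number below `2 ^ k`, and a family of such sets by a number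
below `2 ^ 2 ^ k`. -/

namespace CRN

open RAMExpr

/-- The sets of channels `S` and `X` intersect. -/
def Meets (k S X : ℕ) : Prop := ∃ c < k, S.testBit c = true ∧ X.testBit c = true

/-- The set of channels `S` is not contained in `X`. -/
def Leaves (k S X : ℕ) : Prop := ∃ c < k, S.testBit c = true ∧ ¬ X.testBit c = true

/-- No set `X` of channels separates the members of the family `F`. -/
def Inseparable (k F : ℕ) : Prop :=
  ∀ X < 2 ^ k, (∃ S < 2 ^ k, F.testBit S = true ∧ Meets k S X) →
    (∃ S < 2 ^ k, F.testBit S = true ∧ Leaves k S X) →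
    ∃ S < 2 ^ k, F.testBit S = true ∧ Meets k S X ∧ Leaves k S X

/-- The user `u` of the network stored in `μ` may open the nonempty set of channels `S`. -/
def Allowed (n k : ℕ) (μ : ℕ → ℕ) (u S : ℕ) : Prop :=
  S ≠ 0 ∧ (∀ c < k, S.testBit c = true → μ (2 + n + (k * u + c)) ≠ 0) ∧
    ((Finset.range k).filter fun c => S.testBit c = true).card ≤ μ (2 + u)

/-- The family `F` can be realized as the set of the values of an assignment of allowed sets of
channels to the first `u` users. -/
def Reachable (k : ℕ) (A : ℕ → ℕ → Prop) : ℕ → ℕ → Prop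
  | 0, F => F = 0
  | u + 1, F => ∃ S < 2 ^ k, F.testBit S = true ∧ A u S ∧
      (Reachable k A u F ∨ Reachable k A u (F - 2 ^ S))

/-- The meaning of the table entry in row `u` and column `F`. -/
def Entry (n k : ℕ) (A : ℕ → ℕ → Prop) (u F : ℕ) : Prop :=
  (u ≤ n ∧ Reachable k A u F) ∨ (n < u ∧ ∃ F' ≤ F, Reachable k A n F' ∧ Inseparable k F')

/-! ### The conditions of the recursion as expressions -/

def meetsExpr (s x : ℕ) : RAMExpr := any 1 (and (bit 1 (s + 2) 1) (bit 1 (x + 2) 1))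

def leavesExpr (s x : ℕ) : RAMExpr := any 1 (and (bit 1 (s + 2) 1) (not (bit 1 (x + 2) 1)))

def inseparableExpr (f : ℕ) : RAMExpr :=
  not (any 2 (and (any 2 (and (bit 2 (f + 4) 1) (meetsExpr 1 3)))
    (and (any 2 (and (bit 2 (f + 4) 1) (leavesExpr 1 3)))
      (not (any 2 (and (bit 2 (f + 4) 1) (and (meetsExpr 1 3) (leavesExpr 1 3))))))))

def allowedExpr (u s : ℕ) : RAMExpr :=
  and (var s) (and
    (not (any 1 (and (bit 1 (s + 2) 1)
      (not (load (add (add (const 2) (glob 0)) (add (times 1 (u + 2)) (var 1))))))))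
    (le (popcount 1 s) (load (add (const 2) (var u)))))

/-- The row, but at most `n`, of the table entry with index `glob 6`. -/
def rowExpr : RAMExpr :=
  fold 0 (const 0)
    (ite (le (add (mul 0 1 3) (glob 3)) (glob 6)) (add (var 0) (const 1)) (var 0))

/-- The table entry at the distance `a` before the entry with index `glob 6`. -/
def prevExpr (a : RAMExpr) : RAMExpr := load (add (glob 4) (sub (glob 6) a))

/-- The table entry with index `glob 6`, computed from the previous ones. -/
def entryExpr : RAMExpr :=
  bind rowExpr (bind (sub (glob 6) (mul 0 0 3))
    (ite (le (glob 3) (var 0))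
      (bind (sub (var 0) (glob 3))
        (or (and (var 0) (prevExpr (const 1))) (and (prevExpr (glob 3)) (inseparableExpr 0))))
      (ite (var 1)
        (any 2 (bind (sub (var 3) (const 1))
          (and (bit 2 3 2) (and (allowedExpr 0 2)
            (or (prevExpr (glob 3)) (prevExpr (add (glob 3) (twoPow 2 2))))))))
        (not (var 0)))))

/-! ### Correctness of these expressions -/

section

variable {γ μ env : ℕ → ℕ} {n k : ℕ}

theorem holds_meetsExpr (h1 : γ 1 = k) {s x : ℕ} (hs : env s < 2 ^ k) (hx : env x < 2 ^ k) :
    Holds γ μ (meetsExpr s x) env ↔ Meets k (env s) (env x) := by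
  subst h1
  rw [meetsExpr, holds_any]
  refine exists_congr fun c => and_congr_right fun _ => ?_
  rw [holds_and, holds_bit (by exact hs), holds_bit (by exact hx)]
  rfl

theorem holds_leavesExpr (h1 : γ 1 = k) {s x : ℕ} (hs : env s < 2 ^ k) (hx : env x < 2 ^ k) :
    Holds γ μ (leavesExpr s x) env ↔ Leaves k (env s) (env x) := by
  subst h1
  rw [leavesExpr, holds_any]
  refine exists_congr fun c => and_congr_right fun _ => ?_
  rw [holds_and, holds_not, holds_bit (by exact hs), holds_bit (by exact hx)]
  rfl

theorem holds_inseparableExpr (h1 : γ 1 = k) (h2 : γ 2 = 2 ^ k) {f : ℕ}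
    (hf : env f < 2 ^ 2 ^ k) :
    Holds γ μ (inseparableExpr f) env ↔ Inseparable k (env f) := by
  -- The three quantifiers over members of the family share this form and differ only in the
  -- condition on `S`.
  have key : ∀ (b : RAMExpr) (P : ℕ → Prop) (X : ℕ),
      (∀ S < 2 ^ k, Holds γ μ b (push 0 (push S (push 0 (push X env)))) ↔ P S) →
      (Holds γ μ (any 2 (and (bit 2 (f + 4) 1) b)) (push 0 (push X env)) ↔
        ∃ S < 2 ^ k, (env f).testBit S = true ∧ P S) := by
    intro b P X hP
    rw [holds_any]
    change (∃ i < γ 2, _) ↔ _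
    rw [h2]
    refine exists_congr fun S => and_congr_right fun hS => ?_
    rw [holds_and, hP S hS, holds_bit]
    · rfl
    · change env f < 2 ^ γ 2
      rwa [h2]
  rw [inseparableExpr, holds_not, holds_any]
  change (¬ ∃ i < γ 2, _) ↔ _
  rw [h2]
  simp only [not_exists, not_and, Inseparable]
  refine forall_congr' fun X => forall_congr' fun hX => ?_
  rw [holds_and, holds_and, holds_not,
    key _ (fun S => Meets k S X) X (fun S hS => holds_meetsExpr h1 hS hX),
    key _ (fun S => Leaves k S X) X (fun S hS => holds_leavesExpr h1 hS hX),
    key _ (fun S => Meets k S X ∧ Leaves k S X) X (fun S hS => by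
      rw [holds_and, holds_meetsExpr h1 (by exact hS) (by exact hX),
        holds_leavesExpr h1 (by exact hS) (by exact hX)]; rfl)]
  simp only [not_and, not_not]

theorem holds_allowedExpr (h0 : γ 0 = n) (h1 : γ 1 = k) {u s : ℕ} (hs : env s < 2 ^ k) :
    Holds γ μ (allowedExpr u s) env ↔ Allowed n k μ (env u) (env s) := by
  subst h1 h0
  rw [allowedExpr, holds_and, holds_and, holds_not, holds_any, holds_le, Allowed,
    eval_popcount (by exact hs), holds_var]
  refine and_congr_right fun _ => and_congr ?_ Iff.rfl
  simp only [not_exists, not_and]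
  refine forall_congr' fun c => forall_congr' fun hc => ?_
  rw [holds_and, holds_not, holds_load, holds_bit (by exact hs)]
  simp only [eval, eval_times, push_succ, push_zero]
  change ¬ (((env s).testBit c = true) ∧ ¬ μ (2 + γ 0 + (γ 1 * env u + c)) ≠ 0) ↔ _
  tauto

/-- Division by counting: round `t` tests whether `(t + 1) * γ 3` is at most the index. With only
`n` rounds the count stops at `n`, so rows `n` and `n + 1` are not yet told apart. -/
theorem eval_rowExpr (h0 : γ 0 = n) {u F : ℕ} (hF : F < γ 3) (h6 : γ 6 = u * γ 3 + F) :
    eval γ μ rowExpr env = min u n := by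
  classical
  set f : ℕ → ℕ → ℕ := fun t x => eval γ μ (ite (le (add (mul 0 1 3) (glob 3)) (glob 6))
    (add (var 0) (const 1)) (var 0)) (push x (push t env)) with hf
  suffices H : ∀ N ≤ n, iter f 0 N = min u N by
    have := H n le_rfl
    rw [← h0] at this ⊢
    exact this
  intro N
  induction N with
  | zero => simp [iter]
  | succ N ih =>
    intro hN
    rw [iter, ih (by omega), hf]
    dsimp only
    have h : ∀ x, Holds γ μ (le (add (mul 0 1 3) (glob 3)) (glob 6)) (push x (push N env)) ↔
        N + 1 ≤ u := by
      intro x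
      rw [holds_le, eval_add, eval_mul (by rw [← h0] at hN; exact (Nat.le_succ N).trans hN)]
      change N * γ 3 + γ 3 ≤ γ 6 ↔ _
      rw [h6]
      constructor
      · intro h
        by_contra hc
        have : u * γ 3 ≤ N * γ 3 := Nat.mul_le_mul_right _ (by omega)
        omega
      · intro h
        have : (N + 1) * γ 3 ≤ u * γ 3 := Nat.mul_le_mul_right _ h
        rw [Nat.succ_mul] at this
        omega
    rw [eval_ite]
    simp only [h, eval, push_zero]
    split_ifs <;> omega

end

end CRN

namespace CRN

open RAMExpr

theorem holds_prevExpr {γ μ env : ℕ → ℕ} {a : RAMExpr} :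
    Holds γ μ (prevExpr a) env ↔ μ (γ 4 + (γ 6 - eval γ μ a env)) ≠ 0 := Iff.rfl

/-- The inductive step of the dynamic program: `hμ` is assumed for smaller indices only, which are
the only table cells read. The predicate `A` is kept apart from the current memory because the
memory changes while the table grows. -/
theorem holds_entryExpr {γ μ env : ℕ → ℕ} {n k : ℕ} (h0 : γ 0 = n) (h1 : γ 1 = k)
    (h2 : γ 2 = 2 ^ k) (h3 : γ 3 = 2 ^ 2 ^ k) {u F : ℕ} (hF : F < 2 ^ 2 ^ k) (hu : u ≤ n + 1)
    (h6 : γ 6 = u * 2 ^ 2 ^ k + F) {A : ℕ → ℕ → Prop}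
    (hA : ∀ v < n, ∀ S, Allowed n k μ v S ↔ A v S)
    (hμ : ∀ v G, G < 2 ^ 2 ^ k → v * 2 ^ 2 ^ k + G < u * 2 ^ 2 ^ k + F →
      (μ (γ 4 + (v * 2 ^ 2 ^ k + G)) ≠ 0 ↔ Entry n k A v G)) :
    Holds γ μ entryExpr env ↔ Entry n k A u F := by
  set W := 2 ^ 2 ^ k with hW
  have hrow : ∀ env, eval γ μ rowExpr env = min u n := fun env =>
    eval_rowExpr h0 (F := F) (by rwa [h3]) (by rw [h6, h3])
  have hmul : ∀ env : ℕ → ℕ, eval γ μ (sub (glob 6) (mul 0 0 3)) (push (min u n) env) =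
      u * W + F - min u n * W := by
    intro env
    change γ 6 - _ = _
    rw [eval_mul (by change min u n ≤ γ 0; omega), h6]
    change _ - min u n * γ 3 = _
    rw [h3]
  rw [entryExpr, holds_bind, holds_bind, holds_ite, holds_le, hrow, hmul]
  change (γ 3 ≤ u * W + F - min u n * W ∧ _) ∨ (¬ γ 3 ≤ u * W + F - min u n * W ∧ _) ↔ _
  rw [h3]
  rcases Nat.lt_or_ge n u with hnu | hnu
  · obtain rfl : u = n + 1 := by omega
    -- In row `n + 1` the capped row number leaves the remainder `W + F`, while in every other row
    -- it is `F < W`; this separates the cases.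
    have hd : (n + 1) * W + F - min (n + 1) n * W = W + F := by
      rw [min_eq_right (by omega), Nat.succ_mul]; omega
    rw [hd]
    simp only [le_add_iff_nonneg_right, zero_le, true_and, not_true, false_and, or_false]
    rw [holds_bind]
    have he : eval γ μ (sub (var 0) (glob 3)) (push (W + F) (push (min (n + 1) n) env)) = F := by
      change W + F - γ 3 = F
      rw [h3]; omega
    rw [he, holds_or, holds_and, holds_and, holds_prevExpr, holds_prevExpr, holds_var,
      holds_inseparableExpr h1 h2 (by exact hF), h6]
    change (F ≠ 0 ∧ μ (γ 4 + ((n + 1) * W + F - 1)) ≠ 0) ∨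
      (μ (γ 4 + ((n + 1) * W + F - γ 3)) ≠ 0 ∧ Inseparable k F) ↔ _
    have e1 : (n + 1) * W + F - γ 3 = n * W + F := by rw [h3, Nat.succ_mul]; omega
    rw [e1, hμ n F hF (by rw [Nat.succ_mul]; omega)]
    -- The guard matters: for `F = 0` the preceding cell is the last one of row `n`.
    have e2 : F ≠ 0 → (μ (γ 4 + ((n + 1) * W + F - 1)) ≠ 0 ↔ Entry n k A (n + 1) (F - 1)) := by
      intro h
      rw [show (n + 1) * W + F - 1 = (n + 1) * W + (F - 1) by omega]
      exact hμ _ _ (by omega) (by omega)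
    rw [and_congr_right e2]
    have e3 : ∀ G, Entry n k A (n + 1) G ↔ ∃ F' ≤ G, Reachable k A n F' ∧ Inseparable k F' := by
      intro G
      simp [Entry]
    have e4 : Entry n k A n F ↔ Reachable k A n F := by simp [Entry]
    rw [e3, e3, e4]
    constructor
    · rintro (⟨h, F', h', h''⟩ | h)
      · exact ⟨F', by omega, h''⟩
      · exact ⟨F, le_rfl, h⟩
    · rintro ⟨F', h', h''⟩
      rcases h'.eq_or_lt with rfl | h
      · exact Or.inr h''
      · exact Or.inl ⟨by omega, F', by omega, h''⟩
  · have hd : u * W + F - min u n * W = F := by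
      rw [min_eq_left hnu]; omega
    rw [hd, min_eq_left hnu]
    have hlt : ¬ W ≤ F := by omega
    simp only [hlt, false_and, not_false_iff, true_and, false_or]
    have e4 : ∀ v ≤ n, ∀ G, Entry n k A v G ↔ Reachable k A v G := by
      intro v hv G
      simp [Entry, hv, Nat.not_lt.2 hv]
    rw [e4 u hnu, holds_ite, holds_var, holds_not, holds_var]
    change (u ≠ 0 ∧ _) ∨ (¬ u ≠ 0 ∧ ¬ F ≠ 0) ↔ _
    cases u with
    | zero => simp [Reachable]
    | succ u =>
      simp only [ne_eq, Nat.succ_ne_zero, not_false_eq_true, true_and, not_true, false_and,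
        or_false]
      rw [holds_any, Reachable]
      change (∃ S < γ 2, _) ↔ _
      rw [h2]
      refine exists_congr fun S => and_congr_right fun hS => ?_
      rw [holds_bind, holds_and, holds_and, holds_or, holds_prevExpr, holds_prevExpr, eval_add,
        eval_twoPow, h6, holds_allowedExpr h0 h1 (by exact hS),
        holds_bit (by change F < 2 ^ γ 2; rwa [h2])]
      change (F.testBit S = true ∧ Allowed n k μ u S ∧ (μ (γ 4 + ((u + 1) * W + F - γ 3)) ≠ 0 ∨
        μ (γ 4 + ((u + 1) * W + F - (γ 3 + 2 ^ min S (γ 2)))) ≠ 0)) ↔ _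
      rw [hA u hnu]
      refine and_congr_right fun hFS => and_congr_right fun _ => ?_
      -- This keeps the subtraction within the row: going back `W + 2 ^ S` cells lands in column `F
      -- - 2 ^ S` of the previous row.
      have hle : 2 ^ S ≤ F := Nat.ge_two_pow_of_testBit hFS
      have hpos : 0 < 2 ^ S := by positivity
      rw [h3, h2, min_eq_left hS.le, show (u + 1) * W + F - W = u * W + F by
          rw [Nat.succ_mul]; omega,
        show (u + 1) * W + F - (W + 2 ^ S) = u * W + (F - 2 ^ S) by rw [Nat.succ_mul]; omega,
        hμ u F hF (by rw [Nat.succ_mul]; omega),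
        hμ u (F - 2 ^ S) ((Nat.sub_le _ _).trans_lt hF) (by rw [Nat.succ_mul]; omega), e4 u (by omega), e4 u (by omega)]

/-! ### The meaning of the table -/

theorem testBit_sum_two_pow (s : Finset ℕ) (i : ℕ) :
    (∑ j ∈ s, 2 ^ j).testBit i = true ↔ i ∈ s := by
  rw [← Nat.mem_bitIndices, ← List.mem_toFinset, Finset.toFinset_bitIndices_sum_two_pow]

/-- With the digit `S` present, subtraction deletes one summand from the sum of distinct powers and
involves no borrowing. -/
theorem testBit_sub_two_pow {F S : ℕ} (h : F.testBit S = true) (T : ℕ) :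
    (F - 2 ^ S).testBit T = true ↔ F.testBit T = true ∧ T ≠ S := by
  obtain ⟨s, rfl⟩ : ∃ s : Finset ℕ, F = ∑ j ∈ s, 2 ^ j :=
    ⟨F.bitIndices.toFinset, (Finset.sum_toFinset_bitIndices_two_pow F).symm⟩
  rw [testBit_sum_two_pow] at h ⊢
  rw [← Finset.add_sum_erase s _ h, Nat.add_sub_cancel_left, testBit_sum_two_pow,
    Finset.mem_erase, and_comm]

/-- The two alternatives in `Reachable` correspond to whether the last user's set is also used by an
earlier user; if it is not, the earlier users realize the family without it. -/
theorem reachable_iff {k : ℕ} {A : ℕ → ℕ → Prop} (u F : ℕ) :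
    Reachable k A u F ↔ ∃ s : ℕ → ℕ, (∀ v < u, s v < 2 ^ k ∧ A v (s v)) ∧
      ∀ S, F.testBit S = true ↔ ∃ v < u, s v = S := by
  induction u generalizing F with
  | zero =>
    constructor
    · intro (h : F = 0)
      exact ⟨fun _ => 0, by simp, by simp [h]⟩
    · rintro ⟨s, -, h⟩
      refine Nat.zero_of_testBit_eq_false fun i => ?_
      simpa using h i
  | succ u ih =>
    constructor
    · rintro ⟨S, hS, hF, hA, h⟩
      -- Both alternatives extend an assignment realizing `G` by the value `S`; all that is needed
      -- is that `F` is `G` together with `S`.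
      have key : ∀ G, Reachable k A u G →
          (∀ T, F.testBit T = true ↔ G.testBit T = true ∨ T = S) →
          ∃ s : ℕ → ℕ, (∀ v < u + 1, s v < 2 ^ k ∧ A v (s v)) ∧
            ∀ S, F.testBit S = true ↔ ∃ v < u + 1, s v = S := by
        intro G hG hFG
        obtain ⟨s, hs, hs'⟩ := (ih G).1 hG
        refine ⟨fun v => if v = u then S else s v, fun v hv => ?_, fun T => ?_⟩
        · by_cases h : v = u
          · subst h; simp [hS, hA]
          · simpa [h] using hs v (by omega)
        · rw [hFG, hs', Nat.exists_lt_succ_right]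
          refine or_congr ?_ (by simp [eq_comm])
          refine exists_congr fun v => and_congr_right fun hv => ?_
          simp [hv.ne]
      rcases h with h | h
      · refine key F h fun T => ⟨Or.inl, ?_⟩
        rintro (h | rfl)
        exacts [h, hF]
      · refine key _ h fun T => ?_
        rw [testBit_sub_two_pow hF]
        by_cases hT : T = S
        · simp [hT, hF]
        · simp [hT]
    · rintro ⟨s, hs, hF⟩
      have hFu : F.testBit (s u) = true := (hF _).2 ⟨u, by omega, rfl⟩
      refine ⟨s u, (hs u (by omega)).1, hFu, (hs u (by omega)).2, ?_⟩
      by_cases h : ∃ v < u, s v = s u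
      · refine Or.inl ((ih F).2 ⟨s, fun v hv => hs v (by omega), fun S => ?_⟩)
        rw [hF, Nat.exists_lt_succ_right]
        constructor
        · rintro (h' | rfl)
          exacts [h', h]
        · exact Or.inl
      · refine Or.inr ((ih _).2 ⟨s, fun v hv => hs v (by omega), fun S => ?_⟩)
        rw [testBit_sub_two_pow hFu, hF, Nat.exists_lt_succ_right]
        constructor
        · rintro ⟨h' | rfl, h''⟩
          exacts [h', absurd rfl h'']
        · rintro ⟨v, hv, rfl⟩
          exact ⟨Or.inl ⟨v, hv, rfl⟩, fun h' => h ⟨v, hv, h'⟩⟩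

/-! ### Connectivity through separating channel sets -/

/-- Connectivity of the realization graph in terms of separating sets of channels. -/
theorem connected_realizationGraph_iff {U C : Type*} [Nontrivial U] {N : CRN U C}
    (hN : N.graph = ⊤) (SA : U → Finset C) :
    (N.realizationGraph SA).Connected ↔ (∀ u, (SA u).Nonempty) ∧
      ∀ X : Set C, (∃ u, ∃ c ∈ SA u, c ∈ X) → (∃ u, ∃ c ∈ SA u, c ∉ X) →
        ∃ u, (∃ c ∈ SA u, c ∈ X) ∧ ∃ c ∈ SA u, c ∉ X := by
  constructor
  · intro h
    refine ⟨fun u => ?_, fun X => ?_⟩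
    -- This is where a second user is needed: a neighbour of `u` shares a channel with it.
    · obtain ⟨v, hv⟩ := h.preconnected.exists_adj_of_nontrivial u
      obtain ⟨-, c, hc, -⟩ := hv
      exact ⟨c, hc⟩
    · rintro ⟨u, c, hc, hcX⟩ ⟨v, c', hc', hcX'⟩
      by_contra! hcon
      -- If no user opens channels on both sides of `X`, opening a channel in `X` propagates along
      -- edges.
      have key : ∀ w, (N.realizationGraph SA).Reachable u w → ∃ c ∈ SA w, c ∈ X := by
        intro w hw
        rw [SimpleGraph.reachable_iff_reflTransGen] at hw
        induction hw with
        | refl => exact ⟨c, hc, hcX⟩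
        | tail _ hadj ih =>
          obtain ⟨-, d, hd, hd'⟩ := hadj
          exact ⟨d, hd', hcon _ ih d hd⟩
      exact hcX' (hcon v (key v (h.preconnected u v)) c' hc')
  · rintro ⟨hne, h⟩
    have : Nonempty U := inferInstance
    refine ⟨fun u v => ?_⟩
    by_contra huv
    -- Take for `X` all channels opened in the component of `u`. By completeness, any user opening a
    -- channel of `X` lies in that component, so `v` avoids `X` and no user can open both kinds.
    obtain ⟨w, ⟨c, hc, x, hux, hx⟩, c', hc', hcX'⟩ := h
      {c | ∃ w, (N.realizationGraph SA).Reachable u w ∧ c ∈ SA w}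
      (by
        obtain ⟨c, hc⟩ := hne u
        exact ⟨u, c, hc, u, SimpleGraph.Reachable.refl u, hc⟩)
      (by
        obtain ⟨c, hc⟩ := hne v
        refine ⟨v, c, hc, ?_⟩
        rintro ⟨w, hw, hcw⟩
        by_cases hwv : w = v
        · subst hwv; exact huv hw
        · refine huv (hw.trans (SimpleGraph.Adj.reachable ⟨?_, c, hcw, hc⟩))
          rw [hN]
          exact hwv)
    refine hcX' ⟨w, ?_, hc'⟩
    by_cases hxw : x = w
    · rwa [← hxw]
    · refine hux.trans (SimpleGraph.Adj.reachable ⟨?_, c, hx, hc⟩)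
      rw [hN]
      exact hxw

end CRN

namespace CRN

open RAMExpr

/-! ### Sets of channels as numbers -/

/-- The set of channels represented by a number. -/
def channels (k S : ℕ) : Finset (Fin k) := Finset.univ.filter fun c => S.testBit c = true

theorem mem_channels {k S : ℕ} {c : Fin k} : c ∈ channels k S ↔ S.testBit c = true := by
  simp [channels]

theorem exists_channels_eq {k : ℕ} (s : Finset (Fin k)) : ∃ S < 2 ^ k, channels k S = s := by
  refine ⟨∑ j ∈ s.map Fin.valEmbedding, 2 ^ j, ?_, ?_⟩
  · refine Nat.lt_pow_two_of_testBit _ fun i hi => ?_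
    by_contra h
    rw [Bool.not_eq_false, testBit_sum_two_pow, Finset.mem_map] at h
    obtain ⟨c, -, rfl⟩ := h
    exact absurd c.2 (Nat.not_lt.2 hi)
  · ext c
    rw [mem_channels, testBit_sum_two_pow, Finset.mem_map]
    constructor
    · rintro ⟨c', hc', h⟩
      rwa [← Fin.ext (a := c') (b := c) h]
    · exact fun h => ⟨c, h, rfl⟩

theorem channels_nonempty {k S : ℕ} (hS : S < 2 ^ k) : (channels k S).Nonempty ↔ S ≠ 0 := by
  constructor
  · rintro ⟨c, hc⟩ rfl
    simp [mem_channels] at hc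
  · intro h
    obtain ⟨i, hi⟩ := Nat.exists_testBit_of_ne_zero h
    refine ⟨⟨i, ?_⟩, mem_channels.2 hi⟩
    exact (Nat.pow_lt_pow_iff_right (by norm_num)).1 ((Nat.ge_two_pow_of_testBit hi).trans_lt hS)

theorem card_channels (k S : ℕ) :
    (channels k S).card = ((Finset.range k).filter fun c => S.testBit c = true).card := by
  rw [← Finset.card_map Fin.valEmbedding]
  congr 1
  ext i
  simp only [Finset.mem_map, mem_channels, Finset.mem_filter, Finset.mem_range]
  constructor
  · rintro ⟨c, hc, rfl⟩
    exact ⟨c.2, hc⟩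
  · rintro ⟨hi, h⟩
    exact ⟨⟨i, hi⟩, h, rfl⟩

theorem meets_iff {k S X : ℕ} : Meets k S X ↔ ∃ c ∈ channels k S, c ∈ channels k X := by
  simp only [mem_channels, Meets]
  exact ⟨fun ⟨c, hc, h⟩ => ⟨⟨c, hc⟩, h⟩, fun ⟨c, h⟩ => ⟨c, c.2, h⟩⟩

theorem leaves_iff {k S X : ℕ} : Leaves k S X ↔ ∃ c ∈ channels k S, c ∉ channels k X := by
  simp only [mem_channels, Leaves]
  exact ⟨fun ⟨c, hc, h⟩ => ⟨⟨c, hc⟩, h⟩, fun ⟨c, h⟩ => ⟨c, c.2, h⟩⟩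

/-! ### The table entry that decides connectability -/

/-- The cells of `μ` contain the budgets and the spectrum maps of the network. -/
structure Stored {n k : ℕ} (N : CRN (Fin n) (Fin k)) (μ : ℕ → ℕ) : Prop where
  budget : ∀ u : Fin n, μ (2 + u) = N.budget u
  specMap : ∀ (u : Fin n) (c : Fin k), μ (2 + n + (k * u + c)) ≠ 0 ↔ c ∈ N.specMap u

theorem Stored.allowed_iff {n k : ℕ} {N : CRN (Fin n) (Fin k)} {μ : ℕ → ℕ} (h : N.Stored μ)
    (u : Fin n) {S : ℕ} (hS : S < 2 ^ k) :
    Allowed n k μ u S ↔ (channels k S).Nonempty ∧ channels k S ⊆ N.specMap u ∧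
      (channels k S).card ≤ N.budget u := by
  rw [Allowed, channels_nonempty hS, card_channels, h.budget]
  refine and_congr_right fun _ => and_congr_left fun _ => ?_
  constructor
  · intro H c hc
    exact (h.specMap u c).1 (H c c.2 (mem_channels.1 hc))
  · intro H c hc hSc
    exact (h.specMap u ⟨c, hc⟩).2 (H (mem_channels.2 hSc))

/-- The last column is the largest code of a family, so the prefix search in row `n + 1` covers all
families. The criterion for connectivity requires two users. -/
theorem Stored.connectable_iff {n k : ℕ} {N : CRN (Fin n) (Fin k)} {μ : ℕ → ℕ} (h : N.Stored μ)
    (hn : 2 ≤ n) (hN : N.graph = ⊤) :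
    N.Connectable ↔ Entry n k (Allowed n k μ) (n + 1) (2 ^ 2 ^ k - 1) := by
  have : Nontrivial (Fin n) := Fin.nontrivial_iff_two_le.2 hn
  have key : ∀ s : ℕ → ℕ, (∀ v < n, s v < 2 ^ k) → ∀ F : ℕ,
      (∀ S, F.testBit S = true ↔ ∃ v < n, s v = S) →
      (Inseparable k F ↔ ∀ X : Set (Fin k), (∃ u : Fin n, ∃ c ∈ channels k (s u), c ∈ X) →
        (∃ u : Fin n, ∃ c ∈ channels k (s u), c ∉ X) →
        ∃ u : Fin n, (∃ c ∈ channels k (s u), c ∈ X) ∧ ∃ c ∈ channels k (s u), c ∉ X) := by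
    intro s hs F hF
    -- Since `F` is the set of values of `s`, quantifying over its members is quantifying over
    -- users.
    have hP : ∀ P : ℕ → Prop, (∃ S < 2 ^ k, F.testBit S = true ∧ P S) ↔ ∃ u : Fin n, P (s u) := by
      intro P
      constructor
      · rintro ⟨S, -, hS, hPS⟩
        obtain ⟨v, hv, rfl⟩ := (hF S).1 hS
        exact ⟨⟨v, hv⟩, hPS⟩
      · rintro ⟨u, hu⟩
        exact ⟨s u, hs u u.2, (hF _).2 ⟨u, u.2, rfl⟩, hu⟩
    simp only [Inseparable, hP, meets_iff, leaves_iff]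
    constructor
    · intro H X
      classical
      obtain ⟨x, hx, hX⟩ := exists_channels_eq X.toFinset
      have := H x hx
      simpa only [hX, Set.mem_toFinset] using this
    · exact fun H X _ => H {c | c ∈ channels k X}
  have hE : Entry n k (Allowed n k μ) (n + 1) (2 ^ 2 ^ k - 1) ↔
      ∃ F ≤ 2 ^ 2 ^ k - 1, Reachable k (Allowed n k μ) n F ∧ Inseparable k F := by
    simp [Entry]
  rw [hE]
  constructor
  · rintro ⟨SA, hSA, hconn⟩
    rw [connected_realizationGraph_iff hN] at hconn
    choose f hf hf' using fun u => exists_channels_eq (SA u)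
    -- The value `0` beyond the users is never inspected.
    obtain ⟨s, hs⟩ : ∃ s : ℕ → ℕ, ∀ u : Fin n, s u = f u :=
      ⟨fun v => if h : v < n then f ⟨v, h⟩ else 0, fun u => by simp⟩
    have hs2 : ∀ v < n, s v < 2 ^ k := fun v hv => by
      rw [hs ⟨v, hv⟩]; exact hf _
    have hF : ∀ S, (∑ j ∈ (Finset.range n).image s, 2 ^ j).testBit S = true ↔
        ∃ v < n, s v = S := by
      intro S
      rw [testBit_sum_two_pow]
      simp
    refine ⟨∑ j ∈ (Finset.range n).image s, 2 ^ j, ?_, (reachable_iff _ _).2 ⟨s, ?_, hF⟩, ?_⟩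
    · refine Nat.le_sub_one_of_lt (Nat.lt_pow_two_of_testBit _ fun i hi => ?_)
      by_contra hc
      rw [Bool.not_eq_false, hF] at hc
      obtain ⟨v, hv, rfl⟩ := hc
      exact absurd (hs2 v hv) (Nat.not_lt.2 hi)
    · intro v hv
      refine ⟨hs2 v hv, (h.allowed_iff ⟨v, hv⟩ (hs2 v hv)).2 ?_⟩
      rw [hs ⟨v, hv⟩, hf']
      exact ⟨hconn.1 _, hSA _⟩
    · rw [key s hs2 _ hF]
      simpa only [hs, hf'] using hconn.2
  · rintro ⟨F, -, hR, hI⟩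
    obtain ⟨s, hs, hF⟩ := (reachable_iff _ _).1 hR
    have hA := fun u : Fin n => (h.allowed_iff u (hs u u.2).1).1 (hs u u.2).2
    refine ⟨fun u => channels k (s u), fun u => (hA u).2, ?_⟩
    rw [connected_realizationGraph_iff hN]
    exact ⟨fun u => (hA u).1, (key s (fun v hv => (hs v hv).1) F hF).1 hI⟩

/-- A single vertex is connected even with no open channel, whereas `Allowed` demands a nonempty
set; hence this case bypasses the table. -/
theorem connectable_of_subsingleton {n k : ℕ} (N : CRN (Fin n) (Fin k)) (hn : n = 1) :
    N.Connectable := by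
  subst hn
  refine ⟨fun _ => ∅, fun u => by simp, ⟨fun u v => ?_⟩⟩
  rw [Subsingleton.elim u v]

/-! ### The encoding -/

theorem getD_flatMap_map {α β : Type*} (l : List α) (l' : List β) (f : α → β → ℕ) {i j : ℕ}
    (hi : i < l.length) (hj : j < l'.length) :
    (l.flatMap fun a => l'.map (f a)).getD (l'.length * i + j) 0 = f l[i] l'[j] := by
  induction l generalizing i with
  | nil => simp at hi
  | cons a l ih =>
    rw [List.flatMap_cons]
    cases i with
    | zero =>
      rw [List.getD_append _ _ _ _ (by simpa using hj)]
      simp [hj]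
    | succ i =>
      rw [List.getD_append_right _ _ _ _ (by rw [List.length_map, Nat.mul_succ]; omega),
        List.length_map, show l'.length * (i + 1) + j - l'.length = l'.length * i + j by
          rw [Nat.mul_succ]; omega, ih (by simpa using hi)]
      simp

theorem length_flatMap_map {α β : Type*} (l : List α) (l' : List β) (f : α → β → ℕ) :
    (l.flatMap fun a => l'.map (f a)).length = l.length * l'.length := by
  simp [List.length_flatMap]

theorem stored_encode {n k : ℕ} (N : CRN (Fin n) (Fin k)) :
    N.Stored fun i => N.encode.getD i 0 := by
  classical
  have hlen : ([n, k] ++ List.ofFn N.budget).length = 2 + n := by simp; omega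
  constructor
  · intro u
    unfold encode
    have hu := u.2
    rw [List.getD_append _ _ _ _ (by rw [List.length_append, hlen]; omega),
      List.getD_append _ _ _ _ (by rw [hlen]; omega),
      List.getD_append_right _ _ _ _ (by simp)]
    simp
  · intro u c
    unfold encode
    have hu := u.2
    have hc := c.2
    have hlt : k * u + c < n * k := by
      have := Nat.mul_le_mul_left k (show (u : ℕ) + 1 ≤ n from hu)
      rw [Nat.mul_succ, Nat.mul_comm k n] at this
      omega
    rw [List.getD_append _ _ _ _ (by
        rw [List.length_append, hlen, length_flatMap_map]; simpa using hlt),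
      List.getD_append_right _ _ _ _ (by rw [hlen]; omega), hlen, Nat.add_sub_cancel_left]
    have := getD_flatMap_map (List.finRange n) (List.finRange k)
      (fun u c => if c ∈ N.specMap u then 1 else 0) (i := u) (j := c) (by simp) (by simp)
    simp only [List.length_finRange, List.getElem_finRange] at this
    rw [this]
    simp

theorem encode_getD_zero {n k : ℕ} (N : CRN (Fin n) (Fin k)) : N.encode.getD 0 0 = n := rfl

theorem encode_getD_one {n k : ℕ} (N : CRN (Fin n) (Fin k)) : N.encode.getD 1 0 = k := rfl

/-- Every number contributes at least one to the size, and there are `n` budgets. -/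
theorem le_inputSize_encode {n k : ℕ} (N : CRN (Fin n) (Fin k)) : n ≤ inputSize N.encode := by
  have h : ∀ l : List ℕ, l.length ≤ inputSize l := by
    intro l
    induction l with
    | nil => simp
    | cons a l ih =>
      simp only [inputSize, List.map_cons, List.sum_cons, List.length_cons] at ih ⊢
      omega
  refine le_trans ?_ (h _)
  simp [encode]
  omega

end CRN

namespace CRN

open RAMExpr RAMProg

/-! ### The program -/

/-- Two to the power of the loop bound `j`. -/
def twoPowBound (j : Fin 3) : RAMExpr := fold j (const 1) (add (var 0) (var 0))

theorem eval_twoPowBound {γ μ env : ℕ → ℕ} {j : Fin 3} :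
    eval γ μ (twoPowBound j) env = 2 ^ γ j := by
  suffices H : ∀ N, iter (fun _ x => x + x) 1 N = 2 ^ N from H (γ j)
  intro N
  induction N with
  | zero => rfl
  | succ N ih => rw [iter, ih]; ring

/-- The length of the input. -/
def baseExpr : RAMExpr :=
  add (add (const 2) (glob 0)) (add (bind (glob 0) (times 1 0)) (bind (glob 0) (times 0 0)))

theorem eval_baseExpr {γ μ env : ℕ → ℕ} :
    eval γ μ baseExpr env = 2 + γ 0 + (γ 1 * γ 0 + γ 0 * γ 0) := by
  rw [baseExpr, eval_add, eval_add, eval_add, eval_bind, eval_bind, eval_times, eval_times]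
  rfl

/-- The number of entries of the table. -/
def tableExpr : RAMExpr :=
  add (add (glob 3) (glob 3)) (fold 0 (const 0) (add (var 0) (glob 3)))

theorem eval_tableExpr {γ μ env : ℕ → ℕ} : eval γ μ tableExpr env = (γ 0 + 2) * γ 3 := by
  have H : ∀ N, iter (fun _ x => x + γ 3) 0 N = N * γ 3 := by
    intro N
    induction N with
    | zero => simp [iter]
    | succ N ih => rw [iter, ih, Nat.succ_mul]
  change γ 3 + γ 3 + iter (fun _ x => x + γ 3) 0 (γ 0) = _
  rw [H]
  ring

def answerExpr : RAMExpr :=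
  ite (sub (glob 0) (const 1)) (ite (prevExpr (const 1)) (const 1) (const 0)) (const 1)

/-- Set the global registers to `n`, `k`, `2 ^ k`, `2 ^ 2 ^ k`, the address of the table and the
number of its entries. -/
def prologue : RAMProg :=
  .seq (assign 0 (load (const 0))) (.seq (assign 1 (load (const 1)))
    (.seq (assign 2 (twoPowBound 1)) (.seq (assign 3 (twoPowBound 2))
      (.seq (assign 4 baseExpr) (assign 5 tableExpr)))))

def tableStep : RAMProg :=
  .seq (assign 7 entryExpr) (.seq (.add 8 4 6) (.seq (.store 8 7)
    (.seq (assign 6 (add (glob 6) (const 1))) (assign 5 (sub (glob 5) (const 1))))))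

/-- Compute all table entries, then read off the answer. -/
def decider : RAMProg :=
  .seq prologue (.seq (.while 5 tableStep) (assign 0 answerExpr))

def prologueCost (B : ℕ) : ℕ :=
  (cost B (load (const 0)) + 2) + ((cost B (load (const 1)) + 2) + ((cost B (twoPowBound 1) + 2) +
    ((cost B (twoPowBound 2) + 2) + ((cost B baseExpr + 2) + (cost B tableExpr + 2)))))

def stepCost (B : ℕ) : ℕ :=
  (cost B entryExpr + 2) + (1 + (1 + ((cost B (add (glob 6) (const 1)) + 2) +
    (cost B (sub (glob 5) (const 1)) + 2))))

theorem polyBounded_prologueCost : PolyBounded prologueCost := by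
  have h : ∀ e : RAMExpr, PolyBounded fun B => cost B e + 2 := fun e =>
    (polyBounded_cost e).add (polyBounded_const 2)
  exact (h _).add ((h _).add ((h _).add ((h _).add ((h _).add (h _)))))

theorem polyBounded_stepCost : PolyBounded stepCost := by
  have h : ∀ e : RAMExpr, PolyBounded fun B => cost B e + 2 := fun e =>
    (polyBounded_cost e).add (polyBounded_const 2)
  exact (h _).add ((polyBounded_const 1).add ((polyBounded_const 1).add ((h _).add (h _))))

/-! ### The loop invariant and its preservation -/

/-- The global registers while the table is computed, with `i` entries done. -/
structure Globals (n k i : ℕ) (γ : ℕ → ℕ) : Prop where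
  users : γ 0 = n
  chans : γ 1 = k
  sets : γ 2 = 2 ^ k
  families : γ 3 = 2 ^ 2 ^ k
  base : γ 4 = 2 + n + (k * n + n * n)
  left : γ 5 = (n + 2) * 2 ^ 2 ^ k - i
  done : γ 6 = i

theorem Globals.le {n k i B : ℕ} {γ : ℕ → ℕ} (h : Globals n k i γ) (hn : n ≤ B) (hk : 2 ^ k ≤ B) :
    ∀ j < 3, γ j ≤ B := by
  intro j hj
  interval_cases j
  · rwa [h.users]
  · rw [h.chans]; exact (Nat.lt_two_pow_self).le.trans hk
  · rwa [h.sets]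

/-- Each value is computed by loops over registers set before: `k` doublings give `2 ^ k`, and `2 ^
k` doublings give `2 ^ 2 ^ k`. Loop registers not yet set are `0`, so `B` bounds all rounds
throughout. -/
theorem halts_prologue {n k B : ℕ} {σ : RAMState} (hn : n ≤ B) (hk : 2 ^ k ≤ B)
    (hreg : ∀ r, σ.reg r = 0) (h0 : σ.mem 0 = n) (h1 : σ.mem 1 = k) :
    prologue.Halts σ (prologueCost B) fun τ => τ.mem = σ.mem ∧ Globals n k 0 τ.reg := by
  have hk' : k ≤ B := (Nat.lt_two_pow_self).le.trans hk
  refine Halts.seq ((halts_assign (fun j _ => by simp [hreg]) _ _).mono le_rfl ?_)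
  rintro σ₀ ⟨m0, r0⟩
  have e0 : eval σ.reg σ.mem (load (const 0)) (fun _ => σ.reg 0) = n := h0
  rw [e0] at r0
  refine Halts.seq ((halts_assign (B := B) (fun j hj => ?_) _ _).mono le_rfl ?_)
  · interval_cases j <;> simp [r0, hreg, hn]
  rintro σ₁ ⟨m1, r1⟩
  have e1 : eval σ₀.reg σ₀.mem (load (const 1)) (fun _ => σ₀.reg 0) = k := by
    rw [m0]; exact h1
  rw [e1] at r1
  refine Halts.seq ((halts_assign (B := B) (fun j hj => ?_) _ _).mono le_rfl ?_)
  · interval_cases j <;> simp [r0, r1, hreg, hn, hk']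
  rintro σ₂ ⟨m2, r2⟩
  have e2 : σ₁.reg ((1 : Fin 3) : ℕ) = k := by simp [r1]
  rw [eval_twoPowBound, e2] at r2
  refine Halts.seq ((halts_assign (B := B) (fun j hj => ?_) _ _).mono le_rfl ?_)
  · interval_cases j <;> simp [r0, r1, r2, hn, hk', hk]
  rintro σ₃ ⟨m3, r3⟩
  have e3 : σ₂.reg ((2 : Fin 3) : ℕ) = 2 ^ k := by simp [r2]
  rw [eval_twoPowBound, e3] at r3
  refine Halts.seq ((halts_assign (B := B) (fun j hj => ?_) _ _).mono le_rfl ?_)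
  · interval_cases j <;> simp [r0, r1, r2, r3, hn, hk', hk]
  rintro σ₄ ⟨m4, r4⟩
  rw [eval_baseExpr] at r4
  refine (halts_assign (B := B) (fun j hj => ?_) _ _).mono le_rfl ?_
  · interval_cases j <;> simp [r0, r1, r2, r3, r4, hn, hk', hk]
  rintro σ₅ ⟨m5, r5⟩
  rw [eval_tableExpr] at r5
  refine ⟨by rw [m5, m4, m3, m2, m1, m0], ?_⟩
  constructor <;> simp [r0, r1, r2, r3, r4, r5, hreg]

/-- The memory of the computation when `i` entries of the table are done. -/
structure TableUpTo (n k : ℕ) (μ : ℕ → ℕ) (i : ℕ) (ν : ℕ → ℕ) : Prop where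
  input : ∀ x < 2 + n + (k * n + n * n), ν x = μ x
  entry : ∀ v G, G < 2 ^ 2 ^ k → v * 2 ^ 2 ^ k + G < i →
    (ν (2 + n + (k * n + n * n) + (v * 2 ^ 2 ^ k + G)) ≠ 0 ↔ Entry n k (Allowed n k μ) v G)

theorem TableUpTo.allowed_iff {n k i : ℕ} {μ ν : ℕ → ℕ} (h : TableUpTo n k μ i ν) {v : ℕ}
    (hv : v < n) (S : ℕ) : Allowed n k ν v S ↔ Allowed n k μ v S := by
  have h1 : ν (2 + v) = μ (2 + v) := h.input _ (by omega)
  have h2 : ∀ c < k, ν (2 + n + (k * v + c)) = μ (2 + n + (k * v + c)) := by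
    intro c hc
    refine h.input _ ?_
    have := Nat.mul_le_mul_left k (show v + 1 ≤ n from hv)
    rw [Nat.mul_succ] at this
    omega
  unfold Allowed
  rw [h1]
  refine and_congr_right fun _ => and_congr_left fun _ => ?_
  refine forall_congr' fun c => forall_congr' fun hc => ?_
  rw [h2 c hc]

theorem eq_of_mul_add_eq {W v v' G G' : ℕ} (hG : G < W) (hG' : G' < W)
    (h : v * W + G = v' * W + G') : v = v' ∧ G = G' := by
  have h1 := congrArg (· / W) h
  have h2 := congrArg (· % W) h
  have hW : 0 < W := by omega
  simpa [Nat.mul_comm _ W, Nat.mul_add_div hW, Nat.div_eq_of_lt hG, Nat.div_eq_of_lt hG',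
    Nat.mul_add_mod, Nat.mod_eq_of_lt hG, Nat.mod_eq_of_lt hG'] using And.intro h1 h2

/-- The new cell lies beyond the input and all finished entries, so these survive, and
`holds_entryExpr` accounts for the new one. -/
theorem halts_tableStep {n k i B : ℕ} {μ : ℕ → ℕ} {σ : RAMState} (hn : n ≤ B) (hk : 2 ^ k ≤ B)
    (hi : i < (n + 2) * 2 ^ 2 ^ k) (hγ : Globals n k i σ.reg) (hμ : TableUpTo n k μ i σ.mem) :
    tableStep.Halts σ (stepCost B) fun τ =>
      Globals n k (i + 1) τ.reg ∧ TableUpTo n k μ (i + 1) τ.mem := by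
  have hWpos : 0 < 2 ^ 2 ^ k := by positivity
  obtain ⟨u, F, hF, rfl⟩ : ∃ u F, F < 2 ^ 2 ^ k ∧ i = u * 2 ^ 2 ^ k + F :=
    ⟨i / 2 ^ 2 ^ k, i % 2 ^ 2 ^ k, Nat.mod_lt _ hWpos, (Nat.div_add_mod' _ _).symm⟩
  have hu : u ≤ n + 1 := by
    by_contra h
    have := Nat.mul_le_mul_right (2 ^ 2 ^ k) (show n + 2 ≤ u by omega)
    omega
  have hval : ∀ env, Holds σ.reg σ.mem entryExpr env ↔ Entry n k (Allowed n k μ) u F := by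
    intro env
    refine holds_entryExpr hγ.users hγ.chans hγ.sets hγ.families hF hu hγ.done
      (fun v hv S => hμ.allowed_iff hv S) fun v G hG hlt => ?_
    rw [hγ.base]
    exact hμ.entry v G hG hlt
  set i := u * 2 ^ 2 ^ k + F
  have hγB := hγ.le hn hk
  refine Halts.seq ((halts_assign hγB _ _).mono le_rfl ?_)
  rintro σ₁ ⟨m1, r1⟩
  have hval := hval fun _ => σ.reg 0
  rw [Holds] at hval
  -- Only whether the stored value is nonzero matters, not the value itself.
  generalize eval σ.reg σ.mem entryExpr _ = x at r1 hval
  refine Halts.seq (halts_add (Halts.seq (halts_store ?_)))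
  have r6 : σ₁.reg 6 = i := by simp [r1, hγ.done]
  have r4 : σ₁.reg 4 = 2 + n + (k * n + n * n) := by simp [r1, hγ.base]
  have r7 : σ₁.reg 7 = x := by simp [r1]
  refine Halts.seq ((halts_assign (B := B) (fun j hj => ?_) _ _).mono le_rfl ?_)
  · have a1 : j ≠ 8 := by omega
    have a2 : j ≠ 7 := by omega
    simpa [Function.update, a1, a2, r1 j (by omega)] using hγB j hj
  rintro σ₂ ⟨m2, r2⟩
  have r2' : ∀ r < 6, σ₂.reg r = σ.reg r := by
    intro r hr
    have a1 : r ≠ 6 := by omega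
    have a2 : r ≠ 7 := by omega
    have a3 : r ≠ 8 := by omega
    simp [r2 r (by omega), Function.update, a1, a2, a3, r1 r (by omega)]
  have r26 : σ₂.reg 6 = i + 1 := by
    rw [r2 6 (by norm_num), Function.update_self]
    change Function.update σ₁.reg 8 (σ₁.reg 4 + σ₁.reg 6) 6 + 1 = _
    simp [r6]
  refine (halts_assign (B := B) (fun j hj => ?_) _ _).mono le_rfl ?_
  · rw [r2' j (by omega)]
    exact hγB j hj
  rintro σ₃ ⟨m3, r3⟩
  have r3' : ∀ r < 5, σ₃.reg r = σ.reg r := by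
    intro r hr
    have a1 : r ≠ 5 := by omega
    rw [r3 r (by omega), Function.update_of_ne a1, r2' r (by omega)]
  refine ⟨?_, ?_⟩
  · constructor
    · rw [r3' 0 (by norm_num), hγ.users]
    · rw [r3' 1 (by norm_num), hγ.chans]
    · rw [r3' 2 (by norm_num), hγ.sets]
    · rw [r3' 3 (by norm_num), hγ.families]
    · rw [r3' 4 (by norm_num), hγ.base]
    · rw [r3 5 (by norm_num), Function.update_self]
      change σ₂.reg 5 - 1 = _
      rw [r2' 5 (by norm_num), hγ.left]
      omega
    · rw [r3 6 (by norm_num), Function.update_of_ne (by norm_num), r26]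
  · have hmem : σ₃.mem = Function.update σ.mem (2 + n + (k * n + n * n) + i) x := by
      rw [m3, m2]
      simp [r4, r6, r7, m1]
    rw [hmem]
    constructor
    · intro y hy
      rw [Function.update_of_ne (by omega), hμ.input y hy]
    · intro v G hG hlt
      by_cases h : v * 2 ^ 2 ^ k + G = i
      · obtain ⟨rfl, rfl⟩ := eq_of_mul_add_eq hG hF h
        rw [h, Function.update_self]
        exact hval
      · rw [Function.update_of_ne (by omega)]
        exact hμ.entry v G hG (by omega)

open Classical in
theorem halts_decider {n k B : ℕ} (N : CRN (Fin n) (Fin k)) (hn1 : 1 ≤ n) (hN : N.graph = ⊤)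
    (hn : n ≤ B) (hk : 2 ^ k ≤ B) :
    decider.Halts (RAMState.start N.encode)
      (prologueCost B + (((n + 2) * 2 ^ 2 ^ k * (stepCost B + 1) + 1) + (cost B answerExpr + 2)))
      fun τ => τ.reg 0 = if N.Connectable then 1 else 0 := by
  set μ : ℕ → ℕ := fun i => N.encode.getD i 0
  have hS : N.Stored μ := stored_encode N
  refine Halts.seq ((halts_prologue hn hk (fun _ => rfl) (encode_getD_zero N)
    (encode_getD_one N)).mono le_rfl ?_)
  rintro σ ⟨m0, g0⟩
  refine Halts.seq ((halts_while (fun i τ => Globals n k i τ.reg ∧ TableUpTo n k μ i τ.mem)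
    (fun i hi τ h => ⟨?_, halts_tableStep hn hk hi h.1 h.2⟩) (fun τ h => ?_)
    ⟨g0, fun x _ => by rw [m0]; rfl, fun v G _ h => absurd h (Nat.not_lt_zero _)⟩).mono le_rfl ?_)
  · rw [h.1.left]
    omega
  · rw [h.1.left, Nat.sub_self]
  rintro τ ⟨hγ, hμ⟩
  refine (halts_assign (hγ.le hn hk) _ _).mono le_rfl ?_
  rintro τ' ⟨-, r⟩
  rw [r 0 (by norm_num), Function.update_self, answerExpr, eval_ite, eval_ite]
  change (if τ.reg 0 - 1 ≠ 0 then if τ.mem (τ.reg 4 + (τ.reg 6 - 1)) ≠ 0 then 1 else 0 else 1) = _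
  rw [hγ.users, hγ.base, hγ.done]
  by_cases h : n = 1
  · rw [if_neg (by omega), if_pos (connectable_of_subsingleton N h)]
  · rw [if_pos (by omega)]
    have hW : 0 < 2 ^ 2 ^ k := by positivity
    -- The cell before the end of the table is the last column of row `n + 1`.
    have e : (n + 2) * 2 ^ 2 ^ k - 1 = (n + 1) * 2 ^ 2 ^ k + (2 ^ 2 ^ k - 1) := by
      rw [show n + 2 = n + 1 + 1 from rfl, Nat.succ_mul]
      omega
    have := hμ.entry (n + 1) (2 ^ 2 ^ k - 1) (Nat.sub_lt hW one_pos)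
      (e ▸ Nat.sub_lt (by positivity) one_pos)
    rw [e, if_congr (this.trans (hS.connectable_iff (by omega) hN).symm) rfl rfl]

/-- Both `n` and `2 ^ k` are at most `B = n * 2 ^ k`, so everything except the factor `2 ^ 2 ^ k` is
at most `c * B ^ m`. Here `B ^ m` is `2 ^ (k * m) * n ^ m`, and `c` is absorbed into `2 ^ (c * (k +
1))`, which works even for `k = 0`. -/
theorem exists_decider_time_le : ∃ a b : ℕ, ∀ n k : ℕ, 1 ≤ n →
    prologueCost (n * 2 ^ k) + (((n + 2) * 2 ^ 2 ^ k * (stepCost (n * 2 ^ k) + 1) + 1) +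
      (cost (n * 2 ^ k) answerExpr + 2)) ≤ 2 ^ (2 ^ k + a * (k + 1)) * n ^ b := by
  obtain ⟨c, m, h⟩ := polyBounded_prologueCost.add ((((polyBounded_id.add (polyBounded_const 2)).mul
    (polyBounded_stepCost.add (polyBounded_const 1))).add (polyBounded_const 1)).add
      ((polyBounded_cost answerExpr).add (polyBounded_const 2)))
  refine ⟨c + m, m, fun n k hn => ?_⟩
  have hB : 1 ≤ n * 2 ^ k := Nat.mul_pos hn (by positivity)
  have hnB : n ≤ n * 2 ^ k := Nat.le_mul_of_pos_right _ (by positivity)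
  have hW : 1 ≤ 2 ^ 2 ^ k := Nat.one_le_two_pow
  have hle := h _ hB
  set B := n * 2 ^ k
  set W := 2 ^ 2 ^ k
  calc prologueCost B + (((n + 2) * W * (stepCost B + 1) + 1) + (cost B answerExpr + 2))
      ≤ W * prologueCost B + ((W * ((B + 2) * (stepCost B + 1)) + W * 1) +
          W * (cost B answerExpr + 2)) := by
        have h1 : (n + 2) * W * (stepCost B + 1) ≤ W * ((B + 2) * (stepCost B + 1)) := by
          rw [Nat.mul_comm (n + 2) W, Nat.mul_assoc]
          gcongr
        have h2 := Nat.le_mul_of_pos_left (prologueCost B) hW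
        have h3 := Nat.le_mul_of_pos_left (cost B answerExpr + 2) hW
        omega
    _ = W * (prologueCost B + (((B + 2) * (stepCost B + 1) + 1) + (cost B answerExpr + 2))) := by
        ring
    _ ≤ W * (c * B ^ m) := Nat.mul_le_mul_left _ hle
    _ ≤ W * (2 ^ (c * (k + 1)) * B ^ m) := by
        have : c ≤ 2 ^ (c * (k + 1)) := Nat.lt_two_pow_self.le.trans
          (Nat.pow_le_pow_right (by norm_num) (Nat.le_mul_of_pos_right _ (by omega)))
        gcongr
    _ = 2 ^ (2 ^ k + c * (k + 1) + k * m) * n ^ m := by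
        rw [Nat.mul_pow, pow_add, pow_add, pow_mul 2 k m]
        ring
    _ ≤ 2 ^ (2 ^ k + (c + m) * (k + 1)) * n ^ m := by
        refine Nat.mul_le_mul_right _ (Nat.pow_le_pow_right (by norm_num) ?_)
        rw [Nat.add_mul, Nat.mul_comm k m, Nat.mul_succ m k]
        omega

theorem computable_time (a : ℕ) : Computable fun k : ℕ => 2 ^ (2 ^ k + a * (k + 1)) := by
  have hpow : Primrec fun k : ℕ => 2 ^ k := by
    have : Primrec₂ ((· ^ ·) : ℕ → ℕ → ℕ) := Primrec₂.unpaired'.1 Nat.Primrec.pow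
    exact this.comp (Primrec.const 2) Primrec.id
  exact (hpow.comp (Primrec.nat_add.comp hpow
    (Primrec.nat_mul.comp (Primrec.const a) Primrec.succ))).to_comp

end CRN

theorem mainTheorem5 :
    (∃ (p : RAMProg) (a b : ℕ), ∀ (n k : ℕ) (N : CRN (Fin n) (Fin k)),
      1 ≤ n → N.graph = ⊤ →
        p.DecidesWithin N.encode N.Connectable (2 ^ (2 ^ k + a * (k + 1)) * n ^ b)) ∧
    spectrumConnectivityComplete.IsFPT := by
  obtain ⟨a, b, hab⟩ := CRN.exists_decider_time_le
  have key : ∀ (n k : ℕ) (N : CRN (Fin n) (Fin k)), 1 ≤ n → N.graph = ⊤ →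
      CRN.decider.DecidesWithin N.encode N.Connectable (2 ^ (2 ^ k + a * (k + 1)) * n ^ b) := by
    intro n k N hn hN
    obtain ⟨t, τ, h1, h2, h3⟩ := CRN.halts_decider (B := n * 2 ^ k) N hn hN
      (Nat.le_mul_of_pos_right _ (by positivity)) (Nat.le_mul_of_pos_left _ hn)
    exact ⟨t, τ, h1, h2.trans (hab n k hn), h3⟩
  -- The same program serves both parts, with the first factor of the time bound as `f` and the
  -- exponent `b` as `d`.
  refine ⟨⟨CRN.decider, a, b, key⟩, CRN.decider, _, b, CRN.computable_time a, fun I => ?_⟩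
  obtain ⟨t, τ, h1, h2, h3⟩ := key I.n I.k I.net I.n_pos I.complete
  exact ⟨t, τ, h1, h2.trans (Nat.mul_le_mul_left _
    (Nat.pow_le_pow_left (CRN.le_inputSize_encode I.net) b)), h3⟩
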